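/- Let $\delta_0=x\frac{d}{dx}$. Consider germs at $0\in\mathbb{C}$ of linear differential equations (LDEs) $$\delta_0^2y-p(x)\,\delta_0y-q(x)\,y=0,\qquad p,q \text{ analytic at } 0, \tag{1}$$ i.e. second order LDEs with a regular singularity at the origin (the equations of this form that are actually non-singular at $0$ are allowed too). Its exponents $\{\lambda_1,\lambda_2\}$ are the roots, with multiplicity, of $\lambda^2-p(0)\lambda-q(0)=0$. Two such LDEs are analytically equivalent if a transformation $\tilde x=\phi(x)$, $\tilde y=t(x)y$, with $\phi$ a germ of analytic diffeomorphism fixing $0$ and $t$ an analytic germ with $t(0)\ne0$, carries one to the other. An LDE (1) is reducible if it can be written as $(\delta_0-\alpha_2(x))(\delta_0-\alpha_1(x))y=0$ with $\alpha_1,\alpha_2$ analytic at $0$. Its projective monodromy is the class in $\mathrm{PGL}_2(\mathbb{C})$, well defined up to conjugacy, through which analytic continuation along a simple positive loop around $0$ acts on the quotient $f=y_2/y_1$ of two linearly independent solutions; it is called diagonalizable if it is conjugate to $f\mapsto cf$ for some $c\in\mathbb{C}^*$, and non-diagonalizable if it is conjugate to $f\mapsto f+1$. **Theorem.** 1. Two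 LDEs (1) are analytically equivalent if and only if they have the same exponents $\{\lambda_1,\lambda_2\}$ and conjugate projective monodromies. For two LDEs with the same exponents, the projective monodromies are conjugate if and only if they are both diagonalizable or both non-diagonalizable. (The two properties exclude each other.) 2. Every LDE (1) is reducible, and, its exponents being suitably ordered, it falls into one of the following three cases. (a) The projective monodromy is diagonalizable. Then $\lambda_1\neq\lambda_2$, and the LDE is analytically equivalent to $(\delta_0-\lambda_2)(\delta_0-\lambda_1)y=0$, for which $x^{\lambda_1},x^{\lambda_2}$ is a basis of solutions. (b) $\lambda_1=\lambda_2$. Then the projective monodromy is non-diagonalizable, and the LDE is analytically equivalent to $(\delta_0-\lambda_1)^2y=0$, for which $x^{\lambda_1},x^{\lambda_1}\log x$ is a basis of solutions. (c) $\lambda_1-\lambda_2=k\in\mathbb{Z}_{>0}$ and the projective monodromy is non-diagonalizable. Then the LDE is analytically equivalent to $\big(\delta_0-\lambda_2+k\frac{x^k}{1-x^k}\big)(\delta_0-\lambda_1)y=0$, for which $x^{\lambda_1},\ x^{\lambda_2}+kx^{\lambda_1}\log x$ is a basis of solutions, and also to $(\delta_0-\lambda_2+kx^k)(\delta_0-\lambda_1)y=0$.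 -/

import Mathlib

open Filter Topology

noncomputable section

/-- The Euler operator `δ₀ = x d/dx`. -/
def eulerD (f : ℂ → ℂ) : ℂ → ℂ := fun x => x * deriv f x

/-- The first order operator `δ₀ - α`. -/
def eulerFactor (α : ℂ → ℂ) (f : ℂ → ℂ) : ℂ → ℂ := fun x => eulerD f x - α x * f x

/-- A second order linear differential equation `δ₀² y - p δ₀ y - q y = 0` with coefficients `p`, `q`
analytic at the origin, that is, a second order equation whose singularity at the origin is regular
(Fuchsian). The only equations of this form that are not singular at the origin, those with
`p 0 = 1` and `q = O(x²)`, are not excluded. Only the germs of `p` and `q` at `0` matter. -/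
structure RegularLDE where
  p : ℂ → ℂ
  q : ℂ → ℂ
  analytic_p : AnalyticAt ℂ p 0
  analytic_q : AnalyticAt ℂ q 0

namespace RegularLDE

/-- The left-hand side `δ₀² y - p δ₀ y - q y` of the equation. -/
def op (E : RegularLDE) (y : ℂ → ℂ) : ℂ → ℂ :=
  fun x => eulerD (eulerD y) x - E.p x * eulerD y x - E.q x * y x

/-- Local analytic equivalence by a linear point transformation `x' = φ(x)`, `y' = t(x) y`, where `φ` is
a germ of analytic diffeomorphism fixing the origin and `t` is a nonvanishing analytic germ.
The transformation carries the function `z ↦ f (φ z) / t z` to `f`; its prolongation to 2-jets has to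
carry the first equation to the second one: at each point `x ≠ 0` close to the origin, `f` satisfies the
second equation at the point `φ x` if and only if `z ↦ f (φ z) / t z` satisfies the first one at `x`. -/
def AnalyticallyEquivalent (E E' : RegularLDE) : Prop :=
  ∃ φ t : ℂ → ℂ, AnalyticAt ℂ φ 0 ∧ φ 0 = 0 ∧ deriv φ 0 ≠ 0 ∧ AnalyticAt ℂ t 0 ∧ t 0 ≠ 0 ∧
    ∀ᶠ x in 𝓝[≠] (0 : ℂ), ∀ f : ℂ → ℂ, AnalyticAt ℂ f (φ x) →
      (E'.op f (φ x) = 0 ↔ E.op (fun z => f (φ z) / t z) x = 0)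

/-- The exponents: the pair of roots (with multiplicity) of `X² - p(0) X - q(0)`. -/
def exponents (E : RegularLDE) : Multiset ℂ :=
  (Polynomial.X ^ 2 - Polynomial.C (E.p 0) * Polynomial.X - Polynomial.C (E.q 0)).roots

/-- The equation is reducible: its operator is `(δ₀ - α₂)(δ₀ - α₁)` with `α₁`, `α₂` analytic at `0`. -/
def IsReducible (E : RegularLDE) : Prop :=
  ∃ α₁ α₂ : ℂ → ℂ, AnalyticAt ℂ α₁ 0 ∧ AnalyticAt ℂ α₂ 0 ∧
    ∀ᶠ x in 𝓝 (0 : ℂ), ∀ y : ℂ → ℂ, AnalyticAt ℂ y x →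
      E.op y x = eulerFactor α₂ (eulerFactor α₁ y) x

/-- The half-plane `{w | |exp w| < r}`: the universal covering, by `x = exp w`, of the punctured disc
`0 < |x| < r`. The positive simple loop around the origin corresponds to the deck transformation
`w ↦ w + 2πi`, and `δ₀` becomes `d/dw`. -/
def logDisc (r : ℝ) : Set ℂ := {w | ‖Complex.exp w‖ < r}

/-- `Y` is a (multivalued) solution on the punctured disc of radius `r`, written as a holomorphic function
of `w = log x` on the universal covering. -/
def IsSolution (E : RegularLDE) (r : ℝ) (Y : ℂ → ℂ) : Prop :=
  DifferentiableOn ℂ Y (logDisc r) ∧ ∀ w ∈ logDisc r,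
    deriv (deriv Y) w - E.p (Complex.exp w) * deriv Y w - E.q (Complex.exp w) * Y w = 0

/-- `Y₀`, `Y₁` are two linearly independent solutions on the punctured disc of radius `r`, on which the
coefficients are holomorphic. -/
structure IsFundamentalPair (E : RegularLDE) (r : ℝ) (Y₀ Y₁ : ℂ → ℂ) : Prop where
  pos : 0 < r
  holo_p : DifferentiableOn ℂ E.p (Metric.ball 0 r)
  holo_q : DifferentiableOn ℂ E.q (Metric.ball 0 r)
  sol₀ : E.IsSolution r Y₀
  sol₁ : E.IsSolution r Y₁
  indep : ∀ a b : ℂ, (∀ w ∈ logDisc r, a * Y₀ w + b * Y₁ w = 0) → a = 0 ∧ b = 0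

/-- `Y₀`, `Y₁` form a basis of the space of solutions on the punctured disc of radius `r`. -/
def IsSolutionBasis (E : RegularLDE) (r : ℝ) (Y₀ Y₁ : ℂ → ℂ) : Prop :=
  E.IsFundamentalPair r Y₀ Y₁ ∧ ∀ Y : ℂ → ℂ, E.IsSolution r Y →
    ∃ a b : ℂ, ∀ w ∈ logDisc r, Y w = a * Y₀ w + b * Y₁ w

/-- `ρ ∈ PGL₂(ℂ)` is the projective monodromy of the equation along the positive simple loop, computed for
some quotient `f = Y₀ / Y₁` of two linearly independent solutions: if continuation along the loop acts on
`(Y₀, Y₁)` by the invertible matrix `A`, then `ρ` is the class of `A`, so that `f` is continued to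
`(A₀₀ f + A₀₁) / (A₁₀ f + A₁₁)`. As the loop generates the fundamental group, `ρ` determines the
projective monodromy representation; it is well defined up to conjugacy. -/
def IsProjMonodromy (E : RegularLDE) (ρ : Matrix.ProjGenLinGroup (Fin 2) ℂ) : Prop :=
  ∃ (r : ℝ) (Y₀ Y₁ : ℂ → ℂ) (A : Matrix.GeneralLinearGroup (Fin 2) ℂ),
    E.IsFundamentalPair r Y₀ Y₁ ∧
    (∀ w ∈ logDisc r,
      Y₀ (w + 2 * Real.pi * Complex.I) = A.val 0 0 * Y₀ w + A.val 0 1 * Y₁ w ∧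
      Y₁ (w + 2 * Real.pi * Complex.I) = A.val 1 0 * Y₀ w + A.val 1 1 * Y₁ w) ∧
    ρ = Matrix.ProjGenLinGroup.mk A

/-- The two equations have conjugate projective monodromies. -/
def ProjMonodromyConj (E E' : RegularLDE) : Prop :=
  ∃ ρ ρ' : Matrix.ProjGenLinGroup (Fin 2) ℂ, E.IsProjMonodromy ρ ∧ E'.IsProjMonodromy ρ' ∧ IsConj ρ ρ'

/-- The class in `PGL₂(ℂ)` of the affine map `f ↦ c f + b`. -/
def affineMap (c : ℂˣ) (b : ℂ) : Matrix.ProjGenLinGroup (Fin 2) ℂ :=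
  Matrix.ProjGenLinGroup.mk
    (Matrix.GeneralLinearGroup.mkOfDetNeZero !![(c : ℂ), b; 0, 1] (by simp))

/-- The projective monodromy is diagonalizable: conjugate to `f ↦ c f` for some `c ≠ 0`. -/
def DiagonalizableMonodromy (E : RegularLDE) : Prop :=
  ∃ (ρ : Matrix.ProjGenLinGroup (Fin 2) ℂ) (c : ℂˣ), E.IsProjMonodromy ρ ∧ IsConj ρ (affineMap c 0)

/-- The projective monodromy is non-diagonalizable: conjugate to `f ↦ f + 1`. -/
def NonDiagonalizableMonodromy (E : RegularLDE) : Prop :=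
  ∃ ρ : Matrix.ProjGenLinGroup (Fin 2) ℂ, E.IsProjMonodromy ρ ∧ IsConj ρ (affineMap 1 1)

/-- The equation `(δ₀ - α₂)(δ₀ - α₁) y = 0`. -/
def ofFactors (α₂ α₁ : ℂ → ℂ) (h₂ : AnalyticAt ℂ α₂ 0) (h₁ : AnalyticAt ℂ α₁ 0) : RegularLDE where
  p := fun x => α₁ x + α₂ x
  q := fun x => eulerD α₁ x - α₁ x * α₂ x
  analytic_p := h₁.add h₂
  analytic_q := (analyticAt_id.mul h₁.deriv).sub (h₁.mul h₂)

theorem op_ofFactors (α₂ α₁ : ℂ → ℂ) (h₂ : AnalyticAt ℂ α₂ 0) (h₁ : AnalyticAt ℂ α₁ 0) :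
    ∀ᶠ x in 𝓝 (0 : ℂ), ∀ y : ℂ → ℂ, AnalyticAt ℂ y x →
      (ofFactors α₂ α₁ h₂ h₁).op y x = eulerFactor α₂ (eulerFactor α₁ y) x := by
  filter_upwards [h₁.eventually_analyticAt] with x hx y hy
  have h0 : DifferentiableAt ℂ (eulerD y) x :=
    (analyticAt_id.mul hy.deriv).differentiableAt
  have h1 : deriv (eulerFactor α₁ y) x
      = deriv (eulerD y) x - (deriv α₁ x * y x + α₁ x * deriv y x) := by
    have := (h0.hasDerivAt.sub
      (hx.differentiableAt.hasDerivAt.mul hy.differentiableAt.hasDerivAt)).deriv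
    exact this
  simp only [op, ofFactors, eulerFactor, eulerD] at h1 ⊢
  rw [h1]
  ring

/-- `(δ₀ - λ₂)(δ₀ - λ₁) y = 0` with constants `λ₁ = l₁`, `λ₂ = l₂`. -/
def normalFormA (l₂ l₁ : ℂ) : RegularLDE :=
  ofFactors (fun _ => l₂) (fun _ => l₁) analyticAt_const analyticAt_const

/-- `(δ₀ - λ)² y = 0` with the constant `λ = l`. -/
def normalFormB (l : ℂ) : RegularLDE :=
  ofFactors (fun _ => l) (fun _ => l) analyticAt_const analyticAt_const

theorem analyticAt_normalFormC (l₂ : ℂ) (k : ℕ) (hk : 0 < k) :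
    AnalyticAt ℂ (fun x : ℂ => l₂ - k * (x ^ k / (1 - x ^ k))) 0 := by
  have h : (1 : ℂ) - 0 ^ k ≠ 0 := by simp [hk.ne']
  fun_prop (disch := exact h)

/-- `(δ₀ - λ₂ + k x^k / (1 - x^k))(δ₀ - λ₁) y = 0` with constants `λ₁ = l₁`, `λ₂ = l₂`. -/
def normalFormC (l₂ l₁ : ℂ) (k : ℕ) (hk : 0 < k) : RegularLDE :=
  ofFactors (fun x => l₂ - k * (x ^ k / (1 - x ^ k))) (fun _ => l₁)
    (analyticAt_normalFormC l₂ k hk) analyticAt_const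

/-- `(δ₀ - λ₂ + k x^k)(δ₀ - λ₁) y = 0` with constants `λ₁ = l₁`, `λ₂ = l₂`. -/
def normalFormD (l₂ l₁ : ℂ) (k : ℕ) : RegularLDE :=
  ofFactors (fun x => l₂ - k * x ^ k) (fun _ => l₁) (by fun_prop) analyticAt_const

end RegularLDE

end

/-!
# Local classification of second order equations with a regular singularity

Everything is read off from one normal form for a basis of solutions. If the exponents are ordered so
that `l₁ - l₂` is not a negative integer, Frobenius' series gives a solution `y₁ = x^{l₁} h(x)` with
`h 0 = 1` (`exists_frobenius`, by majorization of the coefficient recursion). Its logarithmic Euler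
derivative `α₁` is a right factor of the operator (`exists_factorization`), whence reducibility, and
reduction of order is a quadrature that yields a second solution
`y₂ = y₁ (x^{l₂ - l₁} V(x) + c log x)`, where `c ≠ 0` is possible only if `l₁ - l₂` is a natural number
and is forced if `l₁ = l₂` (`exists_frobeniusForm`). Solutions are functions of `w = log x` on a
half-plane. No existence theorem for differential equations is needed: two solutions with nonvanishing
Wronskian span all solutions, because quotients of Wronskians are constant
(`isSolutionBasis_of_wronskian`).

On `y₂ / y₁` the loop acts by `f ↦ exp(-2πi (l₁ - l₂)) f + 2πi c`. So the projective monodromy is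
diagonalizable if `c = 0`, and conjugate to `f ↦ f + 1` otherwise, and these two properties exclude each
other (`FrobeniusForm.diagonalizableMonodromy_iff`, `FrobeniusForm.nonDiagonalizableMonodromy_iff`).

A point transformation `x ↦ x exp ψ(x)`, `t = 1 / s` lifts to the half-plane, where equivalence becomes
a pair of identities between the coefficients (`analyticallyEquivalent_iff`). They show that exponents
and projective monodromy are invariants. Conversely, two equations with the same exponents, both with or
both without logarithm, are equivalent (`FrobeniusForm.analyticallyEquivalent`): the implicit function
theorem provides `ψ` carrying the quotient `y₂ / y₁` of one to a multiple of that of the other, then `s`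
is chosen to match the solutions `y₁`; the coefficient identities follow since an operator is determined
by two independent solutions. It remains to exhibit Frobenius bases of the normal forms.
-/

noncomputable section

/-! ### Convergent power series and the Euler operator -/

/-- The coefficient sequence `a` grows at most geometrically, i.e. `∑ aₙ xⁿ` has a positive radius of
convergence. -/
def GeomBounded (a : ℕ → ℂ) : Prop := ∃ C K : ℝ, 0 < C ∧ 0 < K ∧ ∀ n, ‖a n‖ ≤ C * K ^ n

/-- The sum of the power series `∑ aₙ xⁿ`. -/
def powerSum (a : ℕ → ℂ) (x : ℂ) : ℂ := ∑' n, a n * x ^ n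

theorem AnalyticAt.exists_powerSum {f : ℂ → ℂ} (hf : AnalyticAt ℂ f 0) :
    ∃ a, GeomBounded a ∧ ∀ᶠ x in 𝓝 0, f x = powerSum a x := by
  obtain ⟨p, hp⟩ := hf
  refine ⟨p.coeff, ?_, ?_⟩
  · obtain ⟨C, K, hC, hK, h⟩ := p.le_mul_pow_of_radius_pos hp.radius_pos
    refine ⟨C, K, hC, hK, fun n => ?_⟩
    simpa using h n
  · filter_upwards [hasFPowerSeriesAt_iff.1 hp] with x hx
    have := hx.tsum_eq
    simp only [zero_add, smul_eq_mul] at this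
    rw [← this, powerSum]
    simp_rw [mul_comm]

namespace GeomBounded

variable {a b : ℕ → ℂ}

theorem mono (ha : GeomBounded a) {C : ℝ} (h : ∀ n, ‖b n‖ ≤ C * ‖a n‖) : GeomBounded b := by
  obtain ⟨C', K, hC, hK, ha⟩ := ha
  refine ⟨(|C| + 1) * C', K, by positivity, hK, fun n => (h n).trans ?_⟩
  calc C * ‖a n‖ ≤ (|C| + 1) * (C' * K ^ n) := by
        gcongr
        · linarith [le_abs_self C]
        · exact ha n
    _ = _ := by ring

theorem add (ha : GeomBounded a) (hb : GeomBounded b) : GeomBounded fun n => a n + b n := by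
  obtain ⟨C, K, hC, hK, ha⟩ := ha
  obtain ⟨C', K', hC', hK', hb⟩ := hb
  refine ⟨C + C', max K K', by positivity, lt_max_of_lt_left hK, fun n => ?_⟩
  calc ‖a n + b n‖ ≤ C * K ^ n + C' * K' ^ n := (norm_add_le _ _).trans (add_le_add (ha n) (hb n))
    _ ≤ C * (max K K') ^ n + C' * (max K K') ^ n := by
        gcongr
        · exact le_max_left _ _
        · exact le_max_right _ _
    _ = _ := by ring

theorem const_mul (ha : GeomBounded a) (c : ℂ) : GeomBounded fun n => c * a n :=
  ha.mono (C := ‖c‖) fun n => by simp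

theorem natCast_mul (ha : GeomBounded a) : GeomBounded fun n => (n : ℂ) * a n := by
  obtain ⟨C, K, hC, hK, ha⟩ := ha
  refine ⟨C, 2 * K, hC, by positivity, fun n => ?_⟩
  have h2 : (n : ℝ) ≤ 2 ^ n := by exact_mod_cast (Nat.lt_two_pow_self (n := n)).le
  calc ‖(n : ℂ) * a n‖ = n * ‖a n‖ := by simp
    _ ≤ 2 ^ n * (C * K ^ n) := by gcongr; exact ha n
    _ = _ := by rw [mul_pow]; ring

theorem eventually_summable (ha : GeomBounded a) :
    ∀ᶠ x in 𝓝 (0 : ℂ), Summable fun n => ‖a n * x ^ n‖ := by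
  obtain ⟨C, K, hC, hK, ha⟩ := ha
  filter_upwards [Metric.ball_mem_nhds (0 : ℂ) (inv_pos.2 hK)] with x hx
  have hx' : K * ‖x‖ < 1 := by
    rw [mem_ball_zero_iff] at hx
    calc K * ‖x‖ < K * K⁻¹ := by gcongr
      _ = 1 := mul_inv_cancel₀ hK.ne'
  refine Summable.of_nonneg_of_le (fun n => norm_nonneg _) (fun n => ?_)
    ((summable_geometric_of_lt_one (by positivity) hx').mul_left C)
  rw [norm_mul, norm_pow, mul_pow, ← mul_assoc]
  gcongr
  exact ha n

theorem exists_ball (ha : GeomBounded a) : ∃ ρ : ℝ, 0 < ρ ∧ ∃ u : ℕ → ℝ, Summable u ∧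
    ∀ n, ∀ x ∈ Metric.ball (0 : ℂ) ρ, ‖a n * x ^ n‖ ≤ u n := by
  obtain ⟨ε, hε, h⟩ := Metric.eventually_nhds_iff_ball.1 ha.eventually_summable
  refine ⟨ε / 2, by positivity, fun n => ‖a n * ((ε / 2 : ℝ) : ℂ) ^ n‖, h _ ?_, fun n x hx => ?_⟩
  · rw [mem_ball_zero_iff, Complex.norm_real, Real.norm_of_nonneg (by positivity)]
    linarith
  · rw [mem_ball_zero_iff] at hx
    simp only [norm_mul, norm_pow, Complex.norm_real]
    rw [Real.norm_of_nonneg (by positivity)]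
    gcongr

theorem analyticAt_powerSum (ha : GeomBounded a) : AnalyticAt ℂ (powerSum a) 0 := by
  obtain ⟨ρ, hρ, u, hu, h⟩ := ha.exists_ball
  exact (Complex.differentiableOn_tsum_of_summable_norm hu (fun n => by fun_prop)
    Metric.isOpen_ball h).analyticAt (Metric.ball_mem_nhds 0 hρ)

/-- The Euler operator multiplies the `n`-th coefficient of a power series by `n`. -/
theorem eulerD_powerSum (ha : GeomBounded a) :
    ∀ᶠ x in 𝓝 (0 : ℂ), eulerD (powerSum a) x = powerSum (fun n => (n : ℂ) * a n) x := by
  obtain ⟨ρ, hρ, u, hu, h⟩ := ha.exists_ball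
  filter_upwards [Metric.ball_mem_nhds (0 : ℂ) hρ] with x hx
  have := (Complex.hasSum_deriv_of_summable_norm hu (fun n => by fun_prop)
    Metric.isOpen_ball h hx).mul_left x
  rw [eulerD, powerSum]
  refine this.tsum_eq.symm.trans (tsum_congr fun n => ?_)
  rcases n with _ | n
  · simp
  · simp only [deriv_const_mul_field', deriv_pow_field]
    push_cast
    ring

end GeomBounded

theorem powerSum_zero (a : ℕ → ℂ) : powerSum a 0 = a 0 := by
  rw [powerSum, tsum_eq_single 0]
  · simp
  · intro n hn
    simp [hn]

theorem exists_norm_inv_natCast_sub_le (d : ℂ) :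
    ∃ C : ℝ, 0 < C ∧ ∀ n : ℕ, ‖((n : ℂ) - d)⁻¹‖ ≤ C := by
  obtain ⟨N, hN⟩ := exists_nat_gt (‖d‖ + 1)
  refine ⟨1 + ∑ n ∈ Finset.range N, ‖((n : ℂ) - d)⁻¹‖, by positivity, fun n => ?_⟩
  by_cases hn : n < N
  · have := Finset.single_le_sum (f := fun n : ℕ => ‖((n : ℂ) - d)⁻¹‖)
      (fun i _ => norm_nonneg _) (Finset.mem_range.2 hn)
    linarith
  · have h1 : (N : ℝ) ≤ n := by exact_mod_cast not_lt.1 hn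
    have h2 : 1 ≤ ‖(n : ℂ) - d‖ := by
      have := norm_sub_norm_le (n : ℂ) d
      rw [Complex.norm_natCast] at this
      linarith
    have h3 : 0 ≤ ∑ n ∈ Finset.range N, ‖((n : ℂ) - d)⁻¹‖ :=
      Finset.sum_nonneg fun i _ => norm_nonneg _
    rw [norm_inv]
    have := inv_le_one_of_one_le₀ h2
    linarith

/-- Integration of a germ against the Euler operator: `(δ₀ - d) V = G` can be solved up to a resonant
monomial `c xᵏ`, which only occurs when `d = k`. -/
theorem exists_eulerD_sub_mul_eq {G : ℂ → ℂ} (hG : AnalyticAt ℂ G 0) (d : ℂ) (k : ℕ)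
    (hk : ∀ n : ℕ, d = n → n = k) :
    ∃ (c : ℂ) (V : ℂ → ℂ), AnalyticAt ℂ V 0 ∧ (c = 0 ∨ d = k) ∧
      ∀ᶠ x in 𝓝 (0 : ℂ), eulerD V x - d * V x = G x - c * x ^ k := by
  obtain ⟨a, ha, hGa⟩ := hG.exists_powerSum
  obtain ⟨C, -, hC⟩ := exists_norm_inv_natCast_sub_le d
  have hb : GeomBounded fun n => ((n : ℂ) - d)⁻¹ * a n :=
    ha.mono (C := C) fun n => by rw [norm_mul]; gcongr; exact hC n
  refine ⟨if d = k then a k else 0, powerSum fun n => ((n : ℂ) - d)⁻¹ * a n,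
    hb.analyticAt_powerSum, ?_, ?_⟩
  · by_cases h : d = k <;> simp [h]
  · filter_upwards [hGa, hb.eulerD_powerSum, hb.eventually_summable,
      hb.natCast_mul.eventually_summable, ha.eventually_summable] with x h1 h2 h3 h4 h5
    rw [h1, h2]
    have e : HasSum (fun n => (if n = k then (if d = k then a k else 0) * x ^ k else 0))
        ((if d = k then a k else 0) * x ^ k) := hasSum_ite_eq k _
    refine (((h4.of_norm.hasSum).sub (h3.of_norm.hasSum.mul_left d)).unique ?_)
    convert! (h5.of_norm.hasSum).sub e using 2 with n
    by_cases hd : d = n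
    · obtain rfl := hk n hd
      simp [hd]
    · have hd' : (n : ℂ) - d ≠ 0 := sub_ne_zero.2 (Ne.symm hd)
      have : (if n = k then (if d = k then a k else 0) * x ^ k else 0) = 0 := by
        split_ifs with h1 h2
        · exact absurd (h1 ▸ h2) hd
        · simp
        · rfl
      rw [this]
      field_simp
      ring

/-! ### Frobenius series -/

/-- The coefficients of the Frobenius series of exponent `l`: `a₀ = 1`, and `a_{n+1}` is determined by
`χ(n+1) a_{n+1} = ∑_{m ≤ n} (P_{n+1-m} (m + l) + Q_{n+1-m}) aₘ`, where `χ` is the indicial polynomial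
shifted by `l`. -/
def frobeniusCoeff (P Q : ℕ → ℂ) (l : ℂ) : ℕ → ℂ
  | 0 => 1
  | n + 1 => (((n + 1 : ℕ) + l) ^ 2 - P 0 * ((n + 1 : ℕ) + l) - Q 0)⁻¹ *
      ∑ m : Fin (n + 1), (P (n + 1 - m) * ((m : ℕ) + l) + Q (n + 1 - m)) * frobeniusCoeff P Q l m

theorem frobeniusCoeff_succ (P Q : ℕ → ℂ) (l : ℂ) (n : ℕ) :
    frobeniusCoeff P Q l (n + 1) = (((n + 1 : ℕ) + l) ^ 2 - P 0 * ((n + 1 : ℕ) + l) - Q 0)⁻¹ *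
      ∑ m ∈ Finset.range (n + 1),
        (P (n + 1 - m) * (m + l) + Q (n + 1 - m)) * frobeniusCoeff P Q l m := by
  rw [frobeniusCoeff, Fin.sum_univ_eq_sum_range
    (fun m => (P (n + 1 - m) * (m + l) + Q (n + 1 - m)) * frobeniusCoeff P Q l m)]

/-- The Cauchy product form of the recursion. -/
theorem frobeniusCoeff_antidiagonal {P Q : ℕ → ℂ} {l : ℂ} (hl : l ^ 2 - P 0 * l - Q 0 = 0)
    (h : ∀ n : ℕ, ((n + 1 : ℕ) + l) ^ 2 - P 0 * ((n + 1 : ℕ) + l) - Q 0 ≠ 0) (n : ℕ) :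
    (n + l) ^ 2 * frobeniusCoeff P Q l n =
      (∑ i ∈ Finset.HasAntidiagonal.antidiagonal n, P i.1 * ((i.2 + l) * frobeniusCoeff P Q l i.2)) +
      ∑ i ∈ Finset.HasAntidiagonal.antidiagonal n, Q i.1 * frobeniusCoeff P Q l i.2 := by
  rw [← Finset.sum_add_distrib, ← Finset.Nat.sum_antidiagonal_swap,
    Finset.Nat.sum_antidiagonal_eq_sum_range_succ_mk]
  rw [Finset.sum_range_succ]
  simp only [Prod.swap, Nat.sub_self]
  rcases n with _ | n
  · simp [frobeniusCoeff]
    linear_combination hl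
  · have h1 := frobeniusCoeff_succ P Q l n
    rw [inv_mul_eq_div, eq_div_iff (h n)] at h1
    have h2 : ∑ m ∈ Finset.range (n + 1),
        (P (n + 1 - m) * ((m + l) * frobeniusCoeff P Q l m) +
          Q (n + 1 - m) * frobeniusCoeff P Q l m) = ∑ m ∈ Finset.range (n + 1),
        (P (n + 1 - m) * (m + l) + Q (n + 1 - m)) * frobeniusCoeff P Q l m :=
      Finset.sum_congr rfl fun m _ => by ring
    rw [h2]
    linear_combination h1

/-- Majorant estimate for the Frobenius recursion: for a large ratio `K`, the bound `|aₘ| ≤ Kᵐ`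
propagates, because the convolution gains a factor `1 / K` and the indicial polynomial `χ(n)`
dominates `n`. -/
theorem geomBounded_frobeniusCoeff {P Q : ℕ → ℂ} (hP : GeomBounded P) (hQ : GeomBounded Q)
    {l l' : ℂ} (hsum : P 0 = l + l') (hprod : Q 0 = -(l * l')) :
    GeomBounded (frobeniusCoeff P Q l) := by
  obtain ⟨C, hC, hCn'⟩ := exists_norm_inv_natCast_sub_le (-(l - l'))
  have hCn : ∀ n : ℕ, ‖((n + 1 : ℕ) : ℂ) + (l - l')‖⁻¹ ≤ C := fun n => by
    simpa only [sub_neg_eq_add, norm_inv] using hCn' (n + 1)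
  obtain ⟨M₁, R₁, hM₁, hR₁, hP⟩ := hP
  obtain ⟨M₂, R₂, hM₂, hR₂, hQ⟩ := hQ
  set R := max R₁ R₂ with hR
  have hR0 : 0 < R := lt_max_of_lt_left hR₁
  set B := M₁ * (1 + ‖l‖) + M₂ with hB
  have hB0 : 0 < B := by positivity
  -- the coefficients of the convolution kernel are at most `B (n + 1) R^j`
  have hker : ∀ n m j : ℕ, m ≤ n → ‖P j * (m + l) + Q j‖ ≤ B * (n + 1) * R ^ j := by
    intro n m j hmn
    have hm : (m : ℝ) ≤ n := by exact_mod_cast hmn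
    have h1 : ‖(m : ℂ) + l‖ ≤ (1 + ‖l‖) * (n + 1) := by
      refine (norm_add_le _ _).trans ?_
      rw [Complex.norm_natCast]
      nlinarith [norm_nonneg l, (Nat.cast_nonneg n : (0 : ℝ) ≤ n)]
    have h2 : ‖P j‖ ≤ M₁ * R ^ j := (hP j).trans (by gcongr; exact le_max_left _ _)
    have h3 : ‖Q j‖ ≤ M₂ * R ^ j := (hQ j).trans (by gcongr; exact le_max_right _ _)
    calc ‖P j * (m + l) + Q j‖ ≤ ‖P j‖ * ‖(m : ℂ) + l‖ + ‖Q j‖ := by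
          rw [← norm_mul]; exact norm_add_le _ _
      _ ≤ (M₁ * R ^ j) * ((1 + ‖l‖) * (n + 1)) + (M₂ * R ^ j) * (n + 1) := by
          have h4 : ‖Q j‖ ≤ M₂ * R ^ j * (n + 1) := by
            refine h3.trans (le_mul_of_one_le_right (by positivity) ?_)
            linarith [(Nat.cast_nonneg n : (0 : ℝ) ≤ n)]
          gcongr
      _ = _ := by rw [hB]; ring
  set K := R * (2 + 2 * C * B) with hK
  have hK0 : 0 < K := by positivity
  have hRK : R / K = (2 + 2 * C * B)⁻¹ := by rw [hK]; field_simp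
  have hRK0 : 0 < R / K := by positivity
  have hgeom : ∀ n : ℕ, ∑ m ∈ Finset.range (n + 1), (R / K) ^ (n + 1 - m) ≤ 2 * (R / K) := by
    intro n
    have hlt : R / K ≤ 1 / 2 := by
      rw [hRK, one_div]
      gcongr
      nlinarith [mul_pos hC hB0]
    rw [← Finset.sum_range_reflect]
    have : ∀ m ∈ Finset.range (n + 1), (R / K) ^ (n + 1 - (n + 1 - 1 - m)) ≤
        (R / K) * (1 / 2) ^ m := by
      intro m hm
      have hm' := Finset.mem_range.1 hm
      rw [show n + 1 - (n + 1 - 1 - m) = m + 1 by omega, pow_succ, mul_comm]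
      gcongr
    refine (Finset.sum_le_sum this).trans ?_
    rw [← Finset.mul_sum, mul_comm]
    gcongr
    have h2 := (summable_geometric_two).sum_le_tsum (Finset.range (n + 1))
      (fun i _ => by positivity)
    rwa [tsum_geometric_two] at h2
  refine ⟨1, K, one_pos, hK0, fun n => ?_⟩
  rw [one_mul]
  induction n using Nat.strong_induction_on with
  | _ n ih =>
    rcases n with _ | n
    · simp [frobeniusCoeff]
    rw [frobeniusCoeff_succ, hsum, hprod]
    have hχ : ((n + 1 : ℕ) + l) ^ 2 - (l + l') * ((n + 1 : ℕ) + l) - -(l * l')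
        = ((n + 1 : ℕ) : ℂ) * (((n + 1 : ℕ) : ℂ) + (l - l')) := by ring
    rw [hχ, norm_mul, norm_inv, norm_mul, Complex.norm_natCast, mul_inv]
    have hS : ‖∑ m ∈ Finset.range (n + 1),
        (P (n + 1 - m) * (m + l) + Q (n + 1 - m)) * frobeniusCoeff P Q l m‖ ≤
        B * ((n + 1 : ℕ) : ℝ) * K ^ (n + 1) * (2 * (R / K)) := by
      refine (norm_sum_le _ _).trans ?_
      have : ∀ m ∈ Finset.range (n + 1),
          ‖(P (n + 1 - m) * (m + l) + Q (n + 1 - m)) * frobeniusCoeff P Q l m‖ ≤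
          B * ((n + 1 : ℕ) : ℝ) * K ^ (n + 1) * (R / K) ^ (n + 1 - m) := by
        intro m hm
        have hm' := Finset.mem_range.1 hm
        rw [norm_mul]
        calc _ ≤ (B * (n + 1) * R ^ (n + 1 - m)) * K ^ m := by
              gcongr
              · exact hker n m _ (by omega)
              · exact ih m hm'
          _ = _ := by
              rw [div_pow]
              have : K ^ (n + 1) = K ^ (n + 1 - m) * K ^ m := by
                rw [← pow_add]; congr 1; omega
              rw [this]
              push_cast
              field_simp
      refine (Finset.sum_le_sum this).trans ?_
      rw [← Finset.mul_sum]
      gcongr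
      exact hgeom n
    have hn0 : (0 : ℝ) < ((n + 1 : ℕ) : ℝ) := by positivity
    calc _ ≤ (((n + 1 : ℕ) : ℝ)⁻¹ * C) * (B * ((n + 1 : ℕ) : ℝ) * K ^ (n + 1) * (2 * (R / K))) := by
          gcongr
          exact hCn n
      _ = (2 * C * B) / (2 + 2 * C * B) * K ^ (n + 1) := by
          rw [hRK]
          field_simp
      _ ≤ 1 * K ^ (n + 1) := by
          gcongr
          rw [div_le_one (by positivity)]
          linarith
      _ = _ := one_mul _

/-- **Frobenius' theorem** for the exponent `l`: if no `l + n` with `n ≥ 1` is an exponent, there is a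
solution `x ^ l h(x)` with `h` analytic and `h 0 = 1`. -/
theorem exists_frobenius {p q : ℂ → ℂ} (hp : AnalyticAt ℂ p 0) (hq : AnalyticAt ℂ q 0) {l l' : ℂ}
    (hsum : p 0 = l + l') (hprod : q 0 = -(l * l'))
    (hne : ∀ n : ℕ, ((n + 1 : ℕ) : ℂ) + (l - l') ≠ 0) :
    ∃ h : ℂ → ℂ, AnalyticAt ℂ h 0 ∧ h 0 = 1 ∧ ∀ᶠ x in 𝓝 (0 : ℂ),
      eulerD (eulerD h) x + 2 * l * eulerD h x + l ^ 2 * h x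
        = p x * (eulerD h x + l * h x) + q x * h x := by
  obtain ⟨P, hP, hpP⟩ := hp.exists_powerSum
  obtain ⟨Q, hQ, hqQ⟩ := hq.exists_powerSum
  have hP0 : P 0 = l + l' := by rw [← hsum, hpP.self_of_nhds, powerSum_zero]
  have hQ0 : Q 0 = -(l * l') := by rw [← hprod, hqQ.self_of_nhds, powerSum_zero]
  have ha := geomBounded_frobeniusCoeff hP hQ hP0 hQ0
  have hanti := frobeniusCoeff_antidiagonal (P := P) (Q := Q) (l := l)
    (by rw [hP0, hQ0]; ring) (fun n => by
      rw [hP0, hQ0, show ((n + 1 : ℕ) + l) ^ 2 - (l + l') * ((n + 1 : ℕ) + l) - -(l * l')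
        = ((n + 1 : ℕ) : ℂ) * (((n + 1 : ℕ) : ℂ) + (l - l')) by ring]
      exact mul_ne_zero (Nat.cast_ne_zero.2 (by omega)) (hne n))
  set a := frobeniusCoeff P Q l with hadef
  have hb : GeomBounded fun n => (n + l) * a n := by
    simp_rw [add_mul]
    exact ha.natCast_mul.add (ha.const_mul l)
  refine ⟨powerSum a, ha.analyticAt_powerSum, by rw [powerSum_zero, hadef, frobeniusCoeff], ?_⟩
  have hee : ∀ᶠ x in 𝓝 (0 : ℂ), eulerD (eulerD (powerSum a)) x
      = powerSum (fun n => (n : ℂ) * ((n : ℂ) * a n)) x := by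
    have h1 := ha.eulerD_powerSum.eventually_nhds
    filter_upwards [h1, ha.natCast_mul.eulerD_powerSum] with x h1 h2
    rw [← h2, eulerD, eulerD, EventuallyEq.deriv_eq h1]
  filter_upwards [hpP, hqQ, ha.eulerD_powerSum, hee, ha.eventually_summable,
    ha.natCast_mul.eventually_summable, ha.natCast_mul.natCast_mul.eventually_summable,
    hP.eventually_summable, hQ.eventually_summable, hb.eventually_summable]
    with x e1 e2 e3 e4 s1 s2 s3 s4 s5 s6
  have e7 : powerSum (fun n => (n + l) * a n) x = eulerD (powerSum a) x + l * powerSum a x := by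
    rw [e3]
    have := (s2.of_norm.hasSum).add (s1.of_norm.hasSum.mul_left l)
    refine Eq.trans (tsum_congr fun n => ?_) this.tsum_eq
    ring
  have e8 := ((s3.of_norm.hasSum).add (s2.of_norm.hasSum.mul_left (2 * l))).add
    (s1.of_norm.hasSum.mul_left (l ^ 2))
  have t5 := (summable_norm_sum_mul_antidiagonal_of_summable_norm s4 s6).of_norm
  have t6 := (summable_norm_sum_mul_antidiagonal_of_summable_norm s5 s1).of_norm
  have key := t5.tsum_add t6
  rw [← tsum_mul_tsum_eq_tsum_sum_antidiagonal_of_summable_norm s4 s6,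
    ← tsum_mul_tsum_eq_tsum_sum_antidiagonal_of_summable_norm s5 s1] at key
  change _ = powerSum P x * powerSum (fun n => (n + l) * a n) x + powerSum Q x * powerSum a x at key
  rw [e1, e2, ← e7, e4, e3, ← key]
  refine e8.tsum_eq.symm.trans (tsum_congr fun n => ?_)
  have : ∀ i ∈ Finset.HasAntidiagonal.antidiagonal n, x ^ i.1 * x ^ i.2 = x ^ n := fun i hi => by
    rw [← pow_add, Finset.HasAntidiagonal.mem_antidiagonal.1 hi]
  have f1 : ∑ i ∈ Finset.HasAntidiagonal.antidiagonal n, P i.1 * x ^ i.1 * ((i.2 + l) * a i.2 * x ^ i.2)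
      = (∑ i ∈ Finset.HasAntidiagonal.antidiagonal n, P i.1 * ((i.2 + l) * a i.2)) * x ^ n := by
    rw [Finset.sum_mul]
    exact Finset.sum_congr rfl fun i hi => by rw [← this i hi]; ring
  have f2 : ∑ i ∈ Finset.HasAntidiagonal.antidiagonal n, Q i.1 * x ^ i.1 * (a i.2 * x ^ i.2)
      = (∑ i ∈ Finset.HasAntidiagonal.antidiagonal n, Q i.1 * a i.2) * x ^ n := by
    rw [Finset.sum_mul]
    exact Finset.sum_congr rfl fun i hi => by rw [← this i hi]; ring
  rw [f1, f2, ← add_mul, ← hanti n]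
  ring

namespace RegularLDE

/-! ### Solutions on the universal covering of the punctured disc -/

theorem mem_logDisc {r : ℝ} {w : ℂ} : w ∈ logDisc r ↔ Complex.exp w ∈ Metric.ball (0 : ℂ) r := by
  rw [mem_ball_zero_iff]; rfl

theorem logDisc_eq {r : ℝ} (hr : 0 < r) : logDisc r = {w | w.re < Real.log r} := by
  ext w
  rw [logDisc, Set.mem_ofPred_eq, Complex.norm_exp, Set.mem_ofPred_eq, Real.lt_log_iff_exp_lt hr]

theorem isOpen_logDisc (r : ℝ) : IsOpen (logDisc r) :=
  isOpen_lt (by fun_prop) continuous_const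

theorem isPreconnected_logDisc {r : ℝ} (hr : 0 < r) : IsPreconnected (logDisc r) := by
  rw [logDisc_eq hr]
  exact (convex_halfSpace_re_lt _).isPreconnected

theorem logDisc_nonempty {r : ℝ} (hr : 0 < r) : (logDisc r).Nonempty := by
  refine ⟨((Real.log r - 1 : ℝ) : ℂ), ?_⟩
  rw [logDisc_eq hr, Set.mem_ofPred_eq, Complex.ofReal_re]
  linarith

theorem logDisc_mono {r r' : ℝ} (h : r' ≤ r) : logDisc r' ⊆ logDisc r :=
  fun _ hw => lt_of_lt_of_le hw h

theorem exp_add_two_pi_I (w : ℂ) : Complex.exp (w + 2 * Real.pi * Complex.I) = Complex.exp w := by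
  rw [Complex.exp_add, Complex.exp_two_pi_mul_I, mul_one]

theorem add_two_pi_I_mem_logDisc {r : ℝ} {w : ℂ} (hw : w ∈ logDisc r) :
    w + 2 * Real.pi * Complex.I ∈ logDisc r := by
  rw [mem_logDisc, exp_add_two_pi_I]
  exact mem_logDisc.1 hw

/-- Under `x = exp w` the Euler operator becomes `d/dw`. -/
theorem hasDerivAt_comp_exp {f : ℂ → ℂ} {w : ℂ} (hf : DifferentiableAt ℂ f (Complex.exp w)) :
    HasDerivAt (fun w => f (Complex.exp w)) (eulerD f (Complex.exp w)) w := by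
  rw [eulerD, mul_comm]
  exact hf.hasDerivAt.comp w (Complex.hasDerivAt_exp w)

namespace IsSolution

variable {E : RegularLDE} {r : ℝ} {Y Z : ℂ → ℂ}

theorem hasDerivAt (h : E.IsSolution r Y) {w : ℂ} (hw : w ∈ logDisc r) :
    HasDerivAt Y (deriv Y w) w :=
  (h.1.differentiableAt ((isOpen_logDisc r).mem_nhds hw)).hasDerivAt

theorem hasDerivAt_deriv (h : E.IsSolution r Y) {w : ℂ} (hw : w ∈ logDisc r) :
    HasDerivAt (deriv Y) (E.p (Complex.exp w) * deriv Y w + E.q (Complex.exp w) * Y w) w := by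
  have h1 := ((h.1.deriv (isOpen_logDisc r)).differentiableAt
    ((isOpen_logDisc r).mem_nhds hw)).hasDerivAt
  have h2 := h.2 w hw
  convert! h1 using 1
  linear_combination -h2

/-- Solutions may be given with an explicit derivative. -/
theorem of_hasDerivAt {Y' : ℂ → ℂ} (h1 : ∀ w ∈ logDisc r, HasDerivAt Y (Y' w) w)
    (h2 : ∀ w ∈ logDisc r,
      HasDerivAt Y' (E.p (Complex.exp w) * Y' w + E.q (Complex.exp w) * Y w) w) :
    E.IsSolution r Y := by
  refine ⟨fun w hw => (h1 w hw).differentiableAt.differentiableWithinAt, fun w hw => ?_⟩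
  have h3 : deriv Y =ᶠ[𝓝 w] Y' := by
    filter_upwards [(isOpen_logDisc r).mem_nhds hw] with z hz using (h1 z hz).deriv
  rw [h3.deriv_eq, (h2 w hw).deriv, (h1 w hw).deriv]
  ring

theorem mono (h : E.IsSolution r Y) {r' : ℝ} (hr : r' ≤ r) : E.IsSolution r' Y :=
  ⟨h.1.mono (logDisc_mono hr), fun w hw => h.2 w (logDisc_mono hr hw)⟩

/-- Abel's identity. -/
theorem hasDerivAt_wronskian (hY : E.IsSolution r Y) (hZ : E.IsSolution r Z) {w : ℂ}
    (hw : w ∈ logDisc r) :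
    HasDerivAt (fun w => Y w * deriv Z w - deriv Y w * Z w)
      (E.p (Complex.exp w) * (Y w * deriv Z w - deriv Y w * Z w)) w := by
  have := ((hY.hasDerivAt hw).mul (hZ.hasDerivAt_deriv hw)).sub
    ((hY.hasDerivAt_deriv hw).mul (hZ.hasDerivAt hw))
  convert! this using 1
  ring

/-- The quotient of two Wronskians is constant. -/
theorem wronskian_quotient_const {Y₀ Y₁ Z₀ Z₁ : ℂ → ℂ} (hr : 0 < r) (hY₀ : E.IsSolution r Y₀)
    (hY₁ : E.IsSolution r Y₁) (hZ₀ : E.IsSolution r Z₀) (hZ₁ : E.IsSolution r Z₁)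
    (hW : ∀ w ∈ logDisc r, Y₀ w * deriv Y₁ w - deriv Y₀ w * Y₁ w ≠ 0) :
    ∃ a : ℂ, ∀ w ∈ logDisc r, Z₀ w * deriv Z₁ w - deriv Z₀ w * Z₁ w
      = a * (Y₀ w * deriv Y₁ w - deriv Y₀ w * Y₁ w) := by
  have key : ∀ w ∈ logDisc r, HasDerivAt (fun w => (Z₀ w * deriv Z₁ w - deriv Z₀ w * Z₁ w) /
      (Y₀ w * deriv Y₁ w - deriv Y₀ w * Y₁ w)) 0 w := fun w hw => by
    have := (hZ₀.hasDerivAt_wronskian hZ₁ hw).div (hY₀.hasDerivAt_wronskian hY₁ hw) (hW w hw)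
    convert! this using 1
    rw [eq_comm, div_eq_zero_iff]
    left
    ring
  obtain ⟨a, ha⟩ := (isOpen_logDisc r).exists_is_const_of_deriv_eq_zero (isPreconnected_logDisc hr)
    (fun w hw => (key w hw).differentiableAt.differentiableWithinAt) (fun w hw => (key w hw).deriv)
  refine ⟨a, fun w hw => ?_⟩
  rw [← ha w hw, div_mul_cancel₀ _ (hW w hw)]

end IsSolution

/-- Two solutions with nonvanishing Wronskian form a basis of solutions: the coordinates of a third
solution are quotients of Wronskians, hence constant. -/
theorem isSolutionBasis_of_wronskian {E : RegularLDE} {r : ℝ} {Y₀ Y₁ : ℂ → ℂ} (hr : 0 < r)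
    (hp : DifferentiableOn ℂ E.p (Metric.ball 0 r)) (hq : DifferentiableOn ℂ E.q (Metric.ball 0 r))
    (h₀ : E.IsSolution r Y₀) (h₁ : E.IsSolution r Y₁)
    (hW : ∀ w ∈ logDisc r, Y₀ w * deriv Y₁ w - deriv Y₀ w * Y₁ w ≠ 0) :
    E.IsSolutionBasis r Y₀ Y₁ := by
  refine ⟨⟨hr, hp, hq, h₀, h₁, fun a b hab => ?_⟩, fun Y hY => ?_⟩
  · obtain ⟨w, hw⟩ := logDisc_nonempty hr
    have h1 := hab w hw
    have h2 : a * deriv Y₀ w + b * deriv Y₁ w = 0 := by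
      have h3 := ((h₀.hasDerivAt hw).const_mul a).add ((h₁.hasDerivAt hw).const_mul b)
      have h4 : (fun w => a * Y₀ w + b * Y₁ w) =ᶠ[𝓝 w] fun _ => 0 := by
        filter_upwards [(isOpen_logDisc r).mem_nhds hw] with z hz using hab z hz
      exact h3.unique ((hasDerivAt_const w (0 : ℂ)).congr_of_eventuallyEq h4)
    constructor
    · refine (mul_eq_zero.1 (?_ : a * (Y₀ w * deriv Y₁ w - deriv Y₀ w * Y₁ w) = 0)).resolve_right
        (hW w hw)
      linear_combination deriv Y₁ w * h1 - Y₁ w * h2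
    · refine (mul_eq_zero.1 (?_ : b * (Y₀ w * deriv Y₁ w - deriv Y₀ w * Y₁ w) = 0)).resolve_right
        (hW w hw)
      linear_combination - deriv Y₀ w * h1 + Y₀ w * h2
  · obtain ⟨a, ha⟩ := IsSolution.wronskian_quotient_const hr h₀ h₁ hY h₁ hW
    obtain ⟨b, hb⟩ := IsSolution.wronskian_quotient_const hr h₀ h₁ h₀ hY hW
    refine ⟨a, b, fun w hw => mul_right_cancel₀ (hW w hw) ?_⟩
    linear_combination Y₀ w * ha w hw + Y₁ w * hb w hw

/-! ### Frobenius bases -/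

/-- The quotient `x⁻ᵈ V(x) + c log x` of two solutions of a Frobenius basis, as a function of
`w = log x`. -/
def frobeniusQuotient (d c : ℂ) (V : ℂ → ℂ) (w : ℂ) : ℂ :=
  Complex.exp (-d * w) * V (Complex.exp w) + c * w

/-- The solution `x^l h(x)`, as a function of `w = log x`. -/
def frobeniusSolution (l : ℂ) (h : ℂ → ℂ) (w : ℂ) : ℂ := Complex.exp (l * w) * h (Complex.exp w)

/-- The functions `x^{l₁} h(x)` and `x^{l₁} h(x) (x^{l₂ - l₁} V(x) + c log x)` form a basis of solutions
on the punctured disc of radius `r`, with `h` nonvanishing. A logarithm occurs (`c ≠ 0`) only if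
`l₁ - l₂` is the natural number `k`; it does occur if `l₁ = l₂`, while `V 0 ≠ 0` if `l₁ ≠ l₂`.
The Wronskian is the square of the first solution times the derivative of the quotient, so that linear
independence is expressed by the nonvanishing of this derivative. -/
structure FrobeniusForm (E : RegularLDE) (l₁ l₂ : ℂ) (k : ℕ) (c : ℂ) (r : ℝ) (h V : ℂ → ℂ) :
    Prop where
  pos : 0 < r
  holo_p : DifferentiableOn ℂ E.p (Metric.ball 0 r)
  holo_q : DifferentiableOn ℂ E.q (Metric.ball 0 r)
  holo_h : DifferentiableOn ℂ h (Metric.ball 0 r)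
  holo_V : DifferentiableOn ℂ V (Metric.ball 0 r)
  h_ne : ∀ x ∈ Metric.ball (0 : ℂ) r, h x ≠ 0
  resonance : c = 0 ∨ l₁ - l₂ = k
  log_of_eq : l₁ = l₂ → c ≠ 0
  V_ne : l₁ ≠ l₂ → V 0 ≠ 0
  sol₀ : E.IsSolution r (frobeniusSolution l₁ h)
  sol₁ : E.IsSolution r
    (fun w => frobeniusSolution l₁ h w * frobeniusQuotient (l₁ - l₂) c V w)
  wronskian : ∀ w ∈ logDisc r, deriv (frobeniusQuotient (l₁ - l₂) c V) w ≠ 0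

theorem hasDerivAt_frobeniusSolution (l : ℂ) {h : ℂ → ℂ} {w : ℂ}
    (hh : DifferentiableAt ℂ h (Complex.exp w)) :
    HasDerivAt (frobeniusSolution l h)
      (Complex.exp (l * w) * (l * h (Complex.exp w) + eulerD h (Complex.exp w))) w := by
  have h1 : HasDerivAt (fun w => Complex.exp (l * w)) (Complex.exp (l * w) * (l * 1)) w :=
    ((hasDerivAt_id w).const_mul l).cexp
  convert! h1.mul (hasDerivAt_comp_exp hh) using 1
  ring

theorem hasDerivAt_frobeniusQuotient (d c : ℂ) {V : ℂ → ℂ} {w : ℂ}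
    (hV : DifferentiableAt ℂ V (Complex.exp w)) :
    HasDerivAt (frobeniusQuotient d c V)
      (Complex.exp (-d * w) * (eulerD V (Complex.exp w) - d * V (Complex.exp w)) + c) w := by
  have h1 := hasDerivAt_frobeniusSolution (-d) hV
  convert! h1.add ((hasDerivAt_id w).const_mul c) using 1
  ring

theorem differentiableAt_of_mem_ball {f : ℂ → ℂ} {r : ℝ} {x : ℂ}
    (hf : DifferentiableOn ℂ f (Metric.ball 0 r)) (hx : x ∈ Metric.ball (0 : ℂ) r) :
    DifferentiableAt ℂ f x :=
  hf.differentiableAt (Metric.isOpen_ball.mem_nhds hx)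

/-- The resonant monomial in the variable `w`. -/
theorem resonant_mul_exp {d c : ℂ} {k : ℕ} (h : c = 0 ∨ d = k) (w : ℂ) :
    Complex.exp (-d * w) * (c * Complex.exp w ^ k) = c := by
  rcases h with rfl | rfl
  · simp
  · rw [← Complex.exp_nat_mul, mul_left_comm, ← Complex.exp_add]
    simp

/-- Reduction of order: a factorization `(δ₀ - α₂)(δ₀ - α₁)` of the equation, with
`α₁ = l₁ + δ₀h / h` and `α₂ = l₂ + δ₀g / g`, and a solution `V` of `h (δ₀ V - (l₁ - l₂) V + c xᵏ) = g`
give a Frobenius basis. -/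
theorem FrobeniusForm.of_factors {E : RegularLDE} {l₁ l₂ : ℂ} {k : ℕ} {c : ℂ} {r : ℝ}
    {h V α₁ α₂ g : ℂ → ℂ} (pos : 0 < r)
    (hα₁ : DifferentiableOn ℂ α₁ (Metric.ball 0 r)) (hα₂ : DifferentiableOn ℂ α₂ (Metric.ball 0 r))
    (hh : DifferentiableOn ℂ h (Metric.ball 0 r)) (hg : DifferentiableOn ℂ g (Metric.ball 0 r))
    (hV : DifferentiableOn ℂ V (Metric.ball 0 r))
    (hp : ∀ x ∈ Metric.ball (0 : ℂ) r, E.p x = α₁ x + α₂ x)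
    (hq : ∀ x ∈ Metric.ball (0 : ℂ) r, E.q x = eulerD α₁ x - α₁ x * α₂ x)
    (hh0 : ∀ x ∈ Metric.ball (0 : ℂ) r, h x ≠ 0) (hg0 : ∀ x ∈ Metric.ball (0 : ℂ) r, g x ≠ 0)
    (eh : ∀ x ∈ Metric.ball (0 : ℂ) r, eulerD h x = (α₁ x - l₁) * h x)
    (eg : ∀ x ∈ Metric.ball (0 : ℂ) r, eulerD g x = (α₂ x - l₂) * g x)
    (eV : ∀ x ∈ Metric.ball (0 : ℂ) r, h x * (eulerD V x - (l₁ - l₂) * V x + c * x ^ k) = g x)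
    (resonance : c = 0 ∨ l₁ - l₂ = k) (log_of_eq : l₁ = l₂ → c ≠ 0) (V_ne : l₁ ≠ l₂ → V 0 ≠ 0) :
    E.FrobeniusForm l₁ l₂ k c r h V := by
  have dα₁ : DifferentiableOn ℂ (eulerD α₁) (Metric.ball 0 r) :=
    differentiableOn_id.mul (hα₁.deriv Metric.isOpen_ball)
  -- first derivatives of the two solutions and of the auxiliary function `u = (δ₀ - α₁) y₂`
  have d1 : ∀ w ∈ logDisc r, HasDerivAt (frobeniusSolution l₁ h)
      (α₁ (Complex.exp w) * frobeniusSolution l₁ h w) w := fun w hw => by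
    have hx := mem_logDisc.1 hw
    convert! hasDerivAt_frobeniusSolution l₁ (differentiableAt_of_mem_ball hh hx) using 1
    rw [eh _ hx, frobeniusSolution]
    ring
  have d2 : ∀ w ∈ logDisc r, HasDerivAt (frobeniusSolution l₂ g)
      (α₂ (Complex.exp w) * frobeniusSolution l₂ g w) w := fun w hw => by
    have hx := mem_logDisc.1 hw
    convert! hasDerivAt_frobeniusSolution l₂ (differentiableAt_of_mem_ball hg hx) using 1
    rw [eg _ hx, frobeniusSolution]
    ring
  have dα : ∀ w ∈ logDisc r, HasDerivAt (fun w => α₁ (Complex.exp w))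
      (eulerD α₁ (Complex.exp w)) w := fun w hw =>
    hasDerivAt_comp_exp (differentiableAt_of_mem_ball hα₁ (mem_logDisc.1 hw))
  have hV' : ∀ w ∈ logDisc r, frobeniusSolution l₁ h w *
      (Complex.exp (-(l₁ - l₂) * w) * (eulerD V (Complex.exp w) - (l₁ - l₂) * V (Complex.exp w)) + c)
      = frobeniusSolution l₂ g w := fun w hw => by
    have hx := mem_logDisc.1 hw
    have e1 := resonant_mul_exp resonance w
    have e2 : Complex.exp (l₂ * w) = Complex.exp (l₁ * w) * Complex.exp (-(l₁ - l₂) * w) := by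
      rw [← Complex.exp_add]; ring_nf
    rw [frobeniusSolution, frobeniusSolution, e2, ← eV _ hx]
    linear_combination - Complex.exp (l₁ * w) * h (Complex.exp w) * e1
  have d3 : ∀ w ∈ logDisc r, HasDerivAt
      (fun w => frobeniusSolution l₁ h w * frobeniusQuotient (l₁ - l₂) c V w)
      (α₁ (Complex.exp w) * (frobeniusSolution l₁ h w * frobeniusQuotient (l₁ - l₂) c V w) +
        frobeniusSolution l₂ g w) w := fun w hw => by
    have hx := mem_logDisc.1 hw
    convert! (d1 w hw).mul (hasDerivAt_frobeniusQuotient (l₁ - l₂) c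
      (differentiableAt_of_mem_ball hV hx)) using 1
    rw [hV' w hw]
    ring
  refine ⟨pos, ?_, ?_, hh, hV, hh0, resonance, log_of_eq, V_ne, ?_, ?_, fun w hw => ?_⟩
  · exact (hα₁.add hα₂).congr hp
  · exact (dα₁.sub (hα₁.mul hα₂)).congr hq
  · refine .of_hasDerivAt d1 fun w hw => ?_
    have hx := mem_logDisc.1 hw
    convert! (dα w hw).mul (d1 w hw) using 1
    rw [hp _ hx, hq _ hx]
    ring
  · refine .of_hasDerivAt d3 fun w hw => ?_
    have hx := mem_logDisc.1 hw
    convert! ((dα w hw).mul (d3 w hw)).add (d2 w hw) using 1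
    rw [hp _ hx, hq _ hx]
    ring
  · have hx := mem_logDisc.1 hw
    rw [(hasDerivAt_frobeniusQuotient (l₁ - l₂) c (differentiableAt_of_mem_ball hV hx)).deriv]
    intro h0
    have := hV' w hw
    rw [h0, mul_zero, frobeniusSolution] at this
    exact mul_ne_zero (Complex.exp_ne_zero _) (hg0 _ hx) this.symm

namespace FrobeniusForm

variable {E : RegularLDE} {l₁ l₂ : ℂ} {k : ℕ} {c : ℂ} {r : ℝ} {h V : ℂ → ℂ}

theorem mono (F : E.FrobeniusForm l₁ l₂ k c r h V) {r' : ℝ} (hr' : 0 < r') (hr : r' ≤ r) :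
    E.FrobeniusForm l₁ l₂ k c r' h V where
  pos := hr'
  holo_p := F.holo_p.mono (Metric.ball_subset_ball hr)
  holo_q := F.holo_q.mono (Metric.ball_subset_ball hr)
  holo_h := F.holo_h.mono (Metric.ball_subset_ball hr)
  holo_V := F.holo_V.mono (Metric.ball_subset_ball hr)
  h_ne x hx := F.h_ne x (Metric.ball_subset_ball hr hx)
  resonance := F.resonance
  log_of_eq := F.log_of_eq
  V_ne := F.V_ne
  sol₀ := F.sol₀.mono hr
  sol₁ := F.sol₁.mono hr
  wronskian w hw := F.wronskian w (logDisc_mono hr hw)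

theorem solution_ne_zero (F : E.FrobeniusForm l₁ l₂ k c r h V) {w : ℂ} (hw : w ∈ logDisc r) :
    frobeniusSolution l₁ h w ≠ 0 :=
  mul_ne_zero (Complex.exp_ne_zero _) (F.h_ne _ (mem_logDisc.1 hw))

theorem hasDerivAt_quotient (F : E.FrobeniusForm l₁ l₂ k c r h V) {w : ℂ} (hw : w ∈ logDisc r) :
    HasDerivAt (frobeniusQuotient (l₁ - l₂) c V) (deriv (frobeniusQuotient (l₁ - l₂) c V) w) w :=
  (hasDerivAt_frobeniusQuotient _ _
    (differentiableAt_of_mem_ball F.holo_V (mem_logDisc.1 hw))).differentiableAt.hasDerivAt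

/-- A Wronskian of the form `y₀² (y₁ / y₀)'`. -/
theorem wronskian_ne_zero (F : E.FrobeniusForm l₁ l₂ k c r h V) {w : ℂ} (hw : w ∈ logDisc r) :
    frobeniusSolution l₁ h w *
      deriv (fun w => frobeniusSolution l₁ h w * frobeniusQuotient (l₁ - l₂) c V w) w -
      deriv (frobeniusSolution l₁ h) w *
        (frobeniusSolution l₁ h w * frobeniusQuotient (l₁ - l₂) c V w) ≠ 0 := by
  have e := ((F.sol₀.hasDerivAt hw).mul (F.hasDerivAt_quotient hw)).deriv
  have e' : deriv (fun w => frobeniusSolution l₁ h w * frobeniusQuotient (l₁ - l₂) c V w) w = _ := e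
  rw [e']
  have := mul_ne_zero (pow_ne_zero 2 (F.solution_ne_zero hw)) (F.wronskian w hw)
  convert! this using 1
  ring

theorem isSolutionBasis (F : E.FrobeniusForm l₁ l₂ k c r h V) :
    E.IsSolutionBasis r (frobeniusSolution l₁ h)
      (fun w => frobeniusSolution l₁ h w * frobeniusQuotient (l₁ - l₂) c V w) :=
  isSolutionBasis_of_wronskian F.pos F.holo_p F.holo_q F.sol₀ F.sol₁
    fun _ hw => F.wronskian_ne_zero hw

end FrobeniusForm

/-! ### Exponents -/

theorem exponents_eq_of_sum_prod {E : RegularLDE} {l₁ l₂ : ℂ} (hp : E.p 0 = l₁ + l₂)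
    (hq : E.q 0 = -(l₁ * l₂)) : E.exponents = {l₁, l₂} := by
  have : (Polynomial.X ^ 2 - Polynomial.C (E.p 0) * Polynomial.X - Polynomial.C (E.q 0))
      = (Polynomial.X - Polynomial.C l₁) * (Polynomial.X - Polynomial.C l₂) := by
    rw [hp, hq]
    simp only [Polynomial.C_add, Polynomial.C_neg, Polynomial.C_mul]
    ring
  rw [exponents, this, Polynomial.roots_mul
    (mul_ne_zero (Polynomial.X_sub_C_ne_zero _) (Polynomial.X_sub_C_ne_zero _)),
    Polynomial.roots_X_sub_C, Polynomial.roots_X_sub_C]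
  rfl

theorem exists_exponents (E : RegularLDE) :
    ∃ l₁ l₂ : ℂ, E.p 0 = l₁ + l₂ ∧ E.q 0 = -(l₁ * l₂) := by
  obtain ⟨s, hs⟩ := IsAlgClosed.exists_pow_nat_eq (E.p 0 ^ 2 + 4 * E.q 0) two_pos
  refine ⟨(E.p 0 + s) / 2, (E.p 0 - s) / 2, by ring, ?_⟩
  linear_combination (-1 / 4) * hs

theorem exponents_eq_iff {E : RegularLDE} {l₁ l₂ : ℂ} :
    E.exponents = {l₁, l₂} ↔ E.p 0 = l₁ + l₂ ∧ E.q 0 = -(l₁ * l₂) := by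
  refine ⟨fun h => ?_, fun h => exponents_eq_of_sum_prod h.1 h.2⟩
  obtain ⟨m₁, m₂, hp, hq⟩ := E.exists_exponents
  rw [exponents_eq_of_sum_prod hp hq] at h
  have h1 := congrArg Multiset.sum h
  have h2 := congrArg Multiset.prod h
  simp only [Multiset.insert_eq_cons, Multiset.sum_cons, Multiset.sum_singleton,
    Multiset.prod_cons, Multiset.prod_singleton] at h1 h2
  exact ⟨hp.trans h1, by rw [hq, h2]⟩

/-- One of the two orderings of a pair of exponents is such that `l₁ - l₂` is not a negative
integer. -/
theorem admissible_or_swap (l₁ l₂ : ℂ) :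
    (∀ n : ℕ, ((n + 1 : ℕ) : ℂ) + (l₁ - l₂) ≠ 0) ∨ (∀ n : ℕ, ((n + 1 : ℕ) : ℂ) + (l₂ - l₁) ≠ 0) := by
  by_contra! H
  obtain ⟨⟨n, hn⟩, m, hm⟩ := H
  have : ((n + 1 + (m + 1) : ℕ) : ℂ) = 0 := by
    push_cast at hn hm ⊢
    linear_combination hn + hm
  exact absurd (Nat.cast_eq_zero.1 this) (by omega)

theorem exists_admissible_exponents (E : RegularLDE) : ∃ l₁ l₂ : ℂ, E.exponents = {l₁, l₂} ∧
    ∀ n : ℕ, ((n + 1 : ℕ) : ℂ) + (l₁ - l₂) ≠ 0 := by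
  obtain ⟨l₁, l₂, hp, hq⟩ := E.exists_exponents
  rcases admissible_or_swap l₁ l₂ with h | h
  · exact ⟨l₁, l₂, exponents_eq_iff.2 ⟨hp, hq⟩, h⟩
  · exact ⟨l₂, l₁, exponents_eq_iff.2 ⟨hp.trans (add_comm _ _), hq.trans (by ring)⟩, h⟩

/-! ### Reducibility and existence of Frobenius bases -/

/-- The Riccati equation satisfied by the logarithmic derivative of a Frobenius solution turns it into
a right factor of the operator. -/
theorem exists_factorization (E : RegularLDE) {l₁ l₂ : ℂ} (hp : E.p 0 = l₁ + l₂)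
    (hq : E.q 0 = -(l₁ * l₂)) (hl : ∀ n : ℕ, ((n + 1 : ℕ) : ℂ) + (l₁ - l₂) ≠ 0) :
    ∃ α₁ α₂ h : ℂ → ℂ, AnalyticAt ℂ α₁ 0 ∧ AnalyticAt ℂ α₂ 0 ∧ AnalyticAt ℂ h 0 ∧ h 0 = 1 ∧
      α₂ 0 = l₂ ∧ ∀ᶠ x in 𝓝 (0 : ℂ), E.p x = α₁ x + α₂ x ∧ E.q x = eulerD α₁ x - α₁ x * α₂ x ∧
        eulerD h x = (α₁ x - l₁) * h x := by
  obtain ⟨h, hh, h0, eh⟩ := exists_frobenius E.analytic_p E.analytic_q hp hq hl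
  have hne : h 0 ≠ 0 := by rw [h0]; exact one_ne_zero
  have hδ : AnalyticAt ℂ (eulerD h) 0 := analyticAt_id.mul hh.deriv
  have hα : AnalyticAt ℂ (fun x => l₁ + eulerD h x / h x) 0 :=
    analyticAt_const.add (hδ.div hh hne)
  refine ⟨fun x => l₁ + eulerD h x / h x, fun x => E.p x - (l₁ + eulerD h x / h x), h, hα,
    E.analytic_p.sub hα, hh, h0, ?_, ?_⟩
  · simp [eulerD, hp]
  · filter_upwards [eh, hh.continuousAt.eventually_ne hne, hh.eventually_analyticAt,
      hδ.eventually_analyticAt] with x ex hx ax aδ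
    refine ⟨by ring, ?_, ?_⟩
    · have e1 : deriv (fun x => l₁ + eulerD h x / h x) x
          = (deriv (eulerD h) x * h x - eulerD h x * deriv h x) / h x ^ 2 :=
        ((aδ.differentiableAt.hasDerivAt.div ax.differentiableAt.hasDerivAt hx).const_add l₁).deriv
      have e2 : eulerD (fun x => l₁ + eulerD h x / h x) x
          = (eulerD (eulerD h) x * h x - eulerD h x ^ 2) / h x ^ 2 := by
        rw [eulerD, e1, eulerD, eulerD]; ring
      rw [e2]
      field_simp
      linear_combination (-h x) * ex
    · field_simp
      ring

theorem isReducible (E : RegularLDE) : E.IsReducible := by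
  obtain ⟨l₁, l₂, hE, hl⟩ := E.exists_admissible_exponents
  obtain ⟨hp, hq⟩ := exponents_eq_iff.1 hE
  obtain ⟨α₁, α₂, _, h₁, h₂, -, -, -, hα⟩ := E.exists_factorization hp hq hl
  refine ⟨α₁, α₂, h₁, h₂, ?_⟩
  filter_upwards [hα, op_ofFactors α₂ α₁ h₂ h₁] with x hx ho y hy
  rw [← ho y hy, op, op, hx.1, hx.2.1]
  rfl

/-- Every equation has a Frobenius basis for exponents `l₁`, `l₂` ordered in such a way that `l₁ - l₂`
is not a negative integer. -/
theorem exists_frobeniusForm (E : RegularLDE) {l₁ l₂ : ℂ} (hp : E.p 0 = l₁ + l₂)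
    (hq : E.q 0 = -(l₁ * l₂)) (hl : ∀ n : ℕ, ((n + 1 : ℕ) : ℂ) + (l₁ - l₂) ≠ 0) (k : ℕ)
    (hk : ∀ n : ℕ, l₁ - l₂ = n → n = k) :
    ∃ (c : ℂ) (r : ℝ) (h V : ℂ → ℂ), E.FrobeniusForm l₁ l₂ k c r h V := by
  obtain ⟨α₁, α₂, h, h₁, h₂, hh, h0, α0, hE⟩ := E.exists_factorization hp hq hl
  have hne : h 0 ≠ 0 := by rw [h0]; exact one_ne_zero
  -- `g = exp L` solves `δ₀ g = (α₂ - l₂) g`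
  obtain ⟨L, hL, eL⟩ : ∃ L : ℂ → ℂ, AnalyticAt ℂ L 0 ∧
      ∀ᶠ x in 𝓝 (0 : ℂ), eulerD L x = α₂ x - l₂ := by
    obtain ⟨c, L, hL, -, eL⟩ := exists_eulerD_sub_mul_eq (h₂.sub (analyticAt_const (v := l₂))) 0 0
      (fun n hn => by simpa using hn.symm)
    have hc := eL.self_of_nhds
    simp [eulerD, α0] at hc
    refine ⟨L, hL, eL.mono fun x hx => ?_⟩
    simpa [hc] using hx
  set g : ℂ → ℂ := fun x => Complex.exp (L x) with hgdef
  have hg : AnalyticAt ℂ g 0 := hL.cexp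
  obtain ⟨c, V, hV, hc, eV⟩ := exists_eulerD_sub_mul_eq (hg.div hh hne) (l₁ - l₂) k hk
  have e0 : -((l₁ - l₂) * V 0) = Complex.exp (L 0) - c * 0 ^ k := by
    simpa [eulerD, h0, hgdef] using eV.self_of_nhds
  have hev : ∀ᶠ x in 𝓝 (0 : ℂ), (E.p x = α₁ x + α₂ x ∧ E.q x = eulerD α₁ x - α₁ x * α₂ x ∧
      eulerD h x = (α₁ x - l₁) * h x) ∧ eulerD L x = α₂ x - l₂ ∧
      eulerD V x - (l₁ - l₂) * V x = (g / h) x - c * x ^ k ∧ h x ≠ 0 ∧ AnalyticAt ℂ α₁ x ∧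
      AnalyticAt ℂ α₂ x ∧ AnalyticAt ℂ h x ∧ AnalyticAt ℂ L x ∧ AnalyticAt ℂ V x := by
    filter_upwards [hE, eL, eV, hh.continuousAt.eventually_ne hne, h₁.eventually_analyticAt,
      h₂.eventually_analyticAt, hh.eventually_analyticAt, hL.eventually_analyticAt,
      hV.eventually_analyticAt] with x a1 a2 a3 a4 a5 a6 a7 a8 a9
    exact ⟨a1, a2, a3, a4, a5, a6, a7, a8, a9⟩
  obtain ⟨r, hr, H⟩ := Metric.eventually_nhds_iff_ball.1 hev
  refine ⟨c, r, h, V, FrobeniusForm.of_factors (α₁ := α₁) (α₂ := α₂) (g := g) hr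
    (fun x hx => ?_) (fun x hx => ?_) (fun x hx => ?_) (fun x hx => ?_) (fun x hx => ?_)
    (fun x hx => (H x hx).1.1) (fun x hx => (H x hx).1.2.1) (fun x hx => ?_)
    (fun x hx => Complex.exp_ne_zero _) (fun x hx => (H x hx).1.2.2) (fun x hx => ?_)
    (fun x hx => ?_) hc (fun he hc0 => ?_) (fun hne hV0 => ?_)⟩
  · obtain ⟨-, -, -, -, a, -⟩ := H x hx
    exact a.differentiableAt.differentiableWithinAt
  · obtain ⟨-, -, -, -, -, a, -⟩ := H x hx
    exact a.differentiableAt.differentiableWithinAt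
  · obtain ⟨-, -, -, -, -, -, a, -⟩ := H x hx
    exact a.differentiableAt.differentiableWithinAt
  · obtain ⟨-, -, -, -, -, -, -, a, -⟩ := H x hx
    exact a.cexp.differentiableAt.differentiableWithinAt
  · obtain ⟨-, -, -, -, -, -, -, -, a⟩ := H x hx
    exact a.differentiableAt.differentiableWithinAt
  · exact (H x hx).2.2.2.1
  · obtain ⟨-, a, -, -, -, -, -, aL, -⟩ := H x hx
    have : deriv g x = Complex.exp (L x) * deriv L x := aL.differentiableAt.hasDerivAt.cexp.deriv
    rw [← a, eulerD, this, eulerD, hgdef]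
    ring
  · obtain ⟨-, -, a, a', -⟩ := H x hx
    rw [a, sub_add_cancel, Pi.div_apply, mul_div_cancel₀ _ a']
  · -- at equal exponents the resonant term has to cancel `g 0 / h 0 ≠ 0`
    subst he
    rw [hc0, sub_self, zero_mul, neg_zero, zero_mul, sub_zero] at e0
    exact Complex.exp_ne_zero _ e0.symm
  · have e1 : c * (0 : ℂ) ^ k = 0 := by
      rcases hc with rfl | hc
      · exact zero_mul _
      · have : k ≠ 0 := by
          rintro rfl
          exact hne (sub_eq_zero.1 (by simpa using hc))
        rw [zero_pow this, mul_zero]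
    rw [hV0, e1, mul_zero, neg_zero, sub_zero] at e0
    exact Complex.exp_ne_zero _ e0.symm

/-! ### Affine maps in the projective linear group -/

theorem affineMap_mul (c c' : ℂˣ) (b b' : ℂ) :
    affineMap c b * affineMap c' b' = affineMap (c * c') (c * b' + b) := by
  rw [affineMap, affineMap, affineMap, ← map_mul]
  congr 1
  ext i j
  fin_cases i <;> fin_cases j <;>
    simp [Matrix.GeneralLinearGroup.mkOfDetNeZero, Matrix.mul_apply, Fin.sum_univ_two]

/-- A nontrivial translation is conjugate to `f ↦ f + 1` by a homothety. -/
theorem isConj_affineMap_one {b : ℂ} (hb : b ≠ 0) : IsConj (affineMap 1 b) (affineMap 1 1) := by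
  rw [isConj_iff]
  refine ⟨affineMap (Units.mk0 b hb)⁻¹ 0, ?_⟩
  rw [mul_inv_eq_iff_eq_mul, affineMap_mul, affineMap_mul]
  simp [hb]

/-- A translation fixes only one point of the projective line, a homothety at least two. -/
theorem not_isConj_affineMap (c : ℂˣ) : ¬ IsConj (affineMap c 0) (affineMap 1 1) := by
  rw [isConj_iff]
  rintro ⟨g, hg⟩
  obtain ⟨P, rfl⟩ := Matrix.ProjGenLinGroup.mk_surjective g
  rw [mul_inv_eq_iff_eq_mul, affineMap, affineMap, ← map_mul, ← map_mul,
    Matrix.ProjGenLinGroup.mk_eq_mk_iff] at hg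
  obtain ⟨u, hu⟩ := hg
  have hu' := fun i j => congrArg (fun M : Matrix.GeneralLinearGroup (Fin 2) ℂ => M.val i j) hu
  have h00 := hu' 0 0
  have h01 := hu' 0 1
  have h10 := hu' 1 0
  have h11 := hu' 1 1
  simp [Matrix.GeneralLinearGroup.mkOfDetNeZero, Matrix.mul_apply, Fin.sum_univ_two]
    at h00 h01 h10 h11
  have hdet := P.det_ne_zero
  rw [Matrix.det_fin_two] at hdet
  have hf : P.val 1 1 = 0 := by
    by_contra hf
    have hu1 : (u : ℂ) = 1 := mul_left_cancel₀ hf (by rw [h11, mul_one])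
    rw [hu1] at h01
    apply hf
    linear_combination -h01
  have he : P.val 1 0 ≠ 0 := by
    intro he
    exact hdet (by rw [he, hf]; ring)
  have hcu : (c : ℂ) * u = 1 := by
    apply mul_left_cancel₀ he
    linear_combination h10
  apply he
  linear_combination P.val 0 0 * hcu - h00

/-! ### The projective monodromy of a Frobenius basis -/

/-- The monodromy matrices of two bases of solutions on the same disc are conjugate. -/
theorem isConj_monodromy {E : RegularLDE} {r : ℝ} {Y₀ Y₁ Z₀ Z₁ : ℂ → ℂ}
    {A B : Matrix.GeneralLinearGroup (Fin 2) ℂ} (hY₀ : E.IsSolution r Y₀) (hY₁ : E.IsSolution r Y₁)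
    (hY : ∀ a b : ℂ, (∀ w ∈ logDisc r, a * Y₀ w + b * Y₁ w = 0) → a = 0 ∧ b = 0)
    (hZ : E.IsSolutionBasis r Z₀ Z₁)
    (hA : ∀ w ∈ logDisc r,
      Y₀ (w + 2 * Real.pi * Complex.I) = A.val 0 0 * Y₀ w + A.val 0 1 * Y₁ w ∧
      Y₁ (w + 2 * Real.pi * Complex.I) = A.val 1 0 * Y₀ w + A.val 1 1 * Y₁ w)
    (hB : ∀ w ∈ logDisc r,
      Z₀ (w + 2 * Real.pi * Complex.I) = B.val 0 0 * Z₀ w + B.val 0 1 * Z₁ w ∧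
      Z₁ (w + 2 * Real.pi * Complex.I) = B.val 1 0 * Z₀ w + B.val 1 1 * Z₁ w) : IsConj A B := by
  obtain ⟨a, b, hab⟩ := hZ.2 Y₀ hY₀
  obtain ⟨c, d, hcd⟩ := hZ.2 Y₁ hY₁
  have hdet : (!![a, b; c, d] : Matrix (Fin 2) (Fin 2) ℂ).det ≠ 0 := by
    rw [Matrix.det_fin_two_of]
    intro h0
    obtain ⟨h1, h2⟩ := hY c (-a) fun w hw => by
      rw [hab w hw, hcd w hw]; linear_combination - Z₁ w * h0
    obtain ⟨h3, h4⟩ := hY d (-b) fun w hw => by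
      rw [hab w hw, hcd w hw]; linear_combination Z₀ w * h0
    exact one_ne_zero (hY 1 0 fun w hw => by
      rw [hab w hw, neg_eq_zero.1 h2, neg_eq_zero.1 h4]; ring).1
  set M := Matrix.GeneralLinearGroup.mkOfDetNeZero _ hdet with hM
  -- continuation of `Y = M Z` along the loop gives `A M Z = M B Z`
  have e0 := fun w hw => (hA w hw).1
  have e1 := fun w hw => (hA w hw).2
  obtain ⟨p0, p1⟩ := hZ.1.indep (A.val 0 0 * a + A.val 0 1 * c - (a * B.val 0 0 + b * B.val 1 0))
    (A.val 0 0 * b + A.val 0 1 * d - (a * B.val 0 1 + b * B.val 1 1)) fun w hw => by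
      have := e0 w hw
      rw [hab _ (add_two_pi_I_mem_logDisc hw), hab w hw, hcd w hw, (hB w hw).1, (hB w hw).2] at this
      linear_combination -this
  obtain ⟨p2, p3⟩ := hZ.1.indep (A.val 1 0 * a + A.val 1 1 * c - (c * B.val 0 0 + d * B.val 1 0))
    (A.val 1 0 * b + A.val 1 1 * d - (c * B.val 0 1 + d * B.val 1 1)) fun w hw => by
      have := e1 w hw
      rw [hcd _ (add_two_pi_I_mem_logDisc hw), hab w hw, hcd w hw, (hB w hw).1, (hB w hw).2] at this
      linear_combination -this
  have hAM : A * M = M * B := by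
    ext i j
    fin_cases i <;> fin_cases j <;>
      simp [hM, Matrix.GeneralLinearGroup.mkOfDetNeZero, Matrix.mul_apply, Fin.sum_univ_two]
    · exact sub_eq_zero.1 p0
    · exact sub_eq_zero.1 p1
    · exact sub_eq_zero.1 p2
    · exact sub_eq_zero.1 p3
  rw [isConj_iff]
  refine ⟨M⁻¹, ?_⟩
  rw [inv_inv, mul_assoc, hAM, inv_mul_cancel_left]

/-- The unit `exp (-2πi d)`. -/
def expUnit (d : ℂ) : ℂˣ := Units.mk0 (Complex.exp (-d * (2 * Real.pi * Complex.I)))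
  (Complex.exp_ne_zero _)

/-- A lift to `GL₂(ℂ)` of the monodromy of a Frobenius basis, the solution with the logarithm coming
first. -/
def frobeniusMatrix (l₁ l₂ c : ℂ) : Matrix.GeneralLinearGroup (Fin 2) ℂ :=
  Matrix.GeneralLinearGroup.mkOfDetNeZero
      !![(expUnit (l₁ - l₂) : ℂ), 2 * Real.pi * Complex.I * c; 0, 1] (by simp) *
    .scalar (Fin 2) (expUnit (-l₁))

theorem mk_frobeniusMatrix (l₁ l₂ c : ℂ) : Matrix.ProjGenLinGroup.mk (frobeniusMatrix l₁ l₂ c)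
    = affineMap (expUnit (l₁ - l₂)) (2 * Real.pi * Complex.I * c) := by
  rw [frobeniusMatrix, map_mul, Matrix.ProjGenLinGroup.mk_scalar, mul_one]
  rfl

namespace FrobeniusForm

variable {E : RegularLDE} {l₁ l₂ : ℂ} {k : ℕ} {c : ℂ} {r : ℝ} {h V : ℂ → ℂ}

theorem expUnit_eq_one (F : E.FrobeniusForm l₁ l₂ k c r h V) (hc : c ≠ 0) :
    expUnit (l₁ - l₂) = 1 := by
  ext
  rw [F.resonance.resolve_left hc, expUnit, Units.val_mk0, Units.val_one, neg_mul, Complex.exp_neg,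
    Complex.exp_nat_mul_two_pi_mul_I, inv_one]

theorem monodromy (F : E.FrobeniusForm l₁ l₂ k c r h V) (w : ℂ) :
    frobeniusSolution l₁ h (w + 2 * Real.pi * Complex.I) *
        frobeniusQuotient (l₁ - l₂) c V (w + 2 * Real.pi * Complex.I)
      = (frobeniusMatrix l₁ l₂ c).val 0 0 *
          (frobeniusSolution l₁ h w * frobeniusQuotient (l₁ - l₂) c V w) +
        (frobeniusMatrix l₁ l₂ c).val 0 1 * frobeniusSolution l₁ h w ∧
    frobeniusSolution l₁ h (w + 2 * Real.pi * Complex.I)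
      = (frobeniusMatrix l₁ l₂ c).val 1 0 *
          (frobeniusSolution l₁ h w * frobeniusQuotient (l₁ - l₂) c V w) +
        (frobeniusMatrix l₁ l₂ c).val 1 1 * frobeniusSolution l₁ h w := by
  have e1 : frobeniusSolution l₁ h (w + 2 * Real.pi * Complex.I)
      = expUnit (-l₁) * frobeniusSolution l₁ h w := by
    rw [frobeniusSolution, frobeniusSolution, exp_add_two_pi_I, mul_add, Complex.exp_add, expUnit,
      Units.val_mk0, neg_neg]
    ring
  have e2 : frobeniusQuotient (l₁ - l₂) c V (w + 2 * Real.pi * Complex.I)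
      = expUnit (l₁ - l₂) * frobeniusQuotient (l₁ - l₂) c V w + 2 * Real.pi * Complex.I * c := by
    have e3 : c * (expUnit (l₁ - l₂) : ℂ) = c := by
      by_cases hc : c = 0
      · simp [hc]
      · rw [F.expUnit_eq_one hc]; simp
    rw [frobeniusQuotient, frobeniusQuotient, exp_add_two_pi_I, mul_add, Complex.exp_add]
    rw [expUnit, Units.val_mk0] at e3 ⊢
    linear_combination -w * e3
  have m00 : (frobeniusMatrix l₁ l₂ c).val 0 0 = expUnit (l₁ - l₂) * expUnit (-l₁) := by
    simp [frobeniusMatrix, Matrix.GeneralLinearGroup.mkOfDetNeZero, Matrix.mul_apply]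
  have m01 : (frobeniusMatrix l₁ l₂ c).val 0 1 = 2 * Real.pi * Complex.I * c * expUnit (-l₁) := by
    simp [frobeniusMatrix, Matrix.GeneralLinearGroup.mkOfDetNeZero, Matrix.mul_apply]
  have m10 : (frobeniusMatrix l₁ l₂ c).val 1 0 = 0 := by
    simp [frobeniusMatrix, Matrix.GeneralLinearGroup.mkOfDetNeZero, Matrix.mul_apply]
  have m11 : (frobeniusMatrix l₁ l₂ c).val 1 1 = expUnit (-l₁) := by
    simp [frobeniusMatrix, Matrix.GeneralLinearGroup.mkOfDetNeZero, Matrix.mul_apply]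
  rw [m00, m01, m10, m11, e1, e2]
  constructor <;> ring

theorem isSolutionBasis_swap (F : E.FrobeniusForm l₁ l₂ k c r h V) :
    E.IsSolutionBasis r (fun w => frobeniusSolution l₁ h w * frobeniusQuotient (l₁ - l₂) c V w)
      (frobeniusSolution l₁ h) := by
  obtain ⟨H, hspan⟩ := F.isSolutionBasis
  refine ⟨⟨H.pos, H.holo_p, H.holo_q, H.sol₁, H.sol₀, fun a b hab => ?_⟩, fun Y hY => ?_⟩
  · exact (H.indep b a fun w hw => by rw [add_comm]; exact hab w hw).symm
  · obtain ⟨a, b, hab⟩ := hspan Y hY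
    exact ⟨b, a, fun w hw => by rw [add_comm]; exact hab w hw⟩

theorem isProjMonodromy (F : E.FrobeniusForm l₁ l₂ k c r h V) :
    E.IsProjMonodromy (affineMap (expUnit (l₁ - l₂)) (2 * Real.pi * Complex.I * c)) :=
  ⟨r, _, _, frobeniusMatrix l₁ l₂ c, F.isSolutionBasis_swap.1, fun w _ => F.monodromy w,
    (mk_frobeniusMatrix l₁ l₂ c).symm⟩

/-- The projective monodromy is well defined up to conjugacy: it is that of a Frobenius basis. Two
fundamental pairs are compared on the smaller disc, where linear independence persists by the identity
theorem. -/
theorem isConj_of_isProjMonodromy (F : E.FrobeniusForm l₁ l₂ k c r h V)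
    {ρ : Matrix.ProjGenLinGroup (Fin 2) ℂ} (hρ : E.IsProjMonodromy ρ) :
    IsConj ρ (affineMap (expUnit (l₁ - l₂)) (2 * Real.pi * Complex.I * c)) := by
  obtain ⟨r', Y₀, Y₁, A, hY, hA, rfl⟩ := hρ
  rw [← mk_frobeniusMatrix]
  refine Matrix.ProjGenLinGroup.mk.map_isConj ?_
  have hs : 0 < min r r' := lt_min F.pos hY.pos
  have G := F.mono hs (min_le_left _ _)
  refine isConj_monodromy (hY.sol₀.mono (min_le_right _ _)) (hY.sol₁.mono (min_le_right _ _))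
    (fun a b hab => hY.indep a b ?_) G.isSolutionBasis_swap
    (fun w hw => hA w (logDisc_mono (min_le_right _ _) hw)) (fun w _ => G.monodromy w)
  have han : AnalyticOnNhd ℂ (fun w => a * Y₀ w + b * Y₁ w) (logDisc r') :=
    ((hY.sol₀.1.const_mul a).add (hY.sol₁.1.const_mul b)).analyticOnNhd (isOpen_logDisc r')
  obtain ⟨w₀, hw₀⟩ := logDisc_nonempty hs
  refine han.eqOn_zero_of_preconnected_of_eventuallyEq_zero (isPreconnected_logDisc hY.pos)
    (logDisc_mono (min_le_right _ _) hw₀) ?_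
  filter_upwards [(isOpen_logDisc _).mem_nhds hw₀] with w hw using hab w hw

theorem diagonalizableMonodromy (F : E.FrobeniusForm l₁ l₂ k c r h V) (hc : c = 0) :
    E.DiagonalizableMonodromy :=
  ⟨_, expUnit (l₁ - l₂), F.isProjMonodromy, by rw [hc, mul_zero]⟩

theorem isConj_translation (F : E.FrobeniusForm l₁ l₂ k c r h V) (hc : c ≠ 0) :
    IsConj (affineMap (expUnit (l₁ - l₂)) (2 * Real.pi * Complex.I * c)) (affineMap 1 1) := by
  rw [F.expUnit_eq_one hc]
  exact isConj_affineMap_one (mul_ne_zero Complex.two_pi_I_ne_zero hc)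

theorem nonDiagonalizableMonodromy (F : E.FrobeniusForm l₁ l₂ k c r h V) (hc : c ≠ 0) :
    E.NonDiagonalizableMonodromy :=
  ⟨_, F.isProjMonodromy, F.isConj_translation hc⟩

theorem diagonalizableMonodromy_iff (F : E.FrobeniusForm l₁ l₂ k c r h V) :
    E.DiagonalizableMonodromy ↔ c = 0 := by
  refine ⟨fun ⟨ρ, u, hρ, hu⟩ => ?_, F.diagonalizableMonodromy⟩
  by_contra hc
  exact not_isConj_affineMap u
    (hu.symm.trans ((F.isConj_of_isProjMonodromy hρ).trans (F.isConj_translation hc)))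

theorem nonDiagonalizableMonodromy_iff (F : E.FrobeniusForm l₁ l₂ k c r h V) :
    E.NonDiagonalizableMonodromy ↔ c ≠ 0 := by
  refine ⟨fun ⟨ρ, hρ, hu⟩ hc => ?_, F.nonDiagonalizableMonodromy⟩
  have := F.isConj_of_isProjMonodromy hρ
  rw [hc, mul_zero] at this
  exact not_isConj_affineMap _ (this.symm.trans hu)

/-- For equal exponents, the projective monodromies are conjugate if and only if logarithms occur for
both equations or for none. -/
theorem projMonodromyConj_iff (F : E.FrobeniusForm l₁ l₂ k c r h V) {E' : RegularLDE} {k' : ℕ}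
    {c' : ℂ} {r' : ℝ} {h' V' : ℂ → ℂ} (F' : E'.FrobeniusForm l₁ l₂ k' c' r' h' V') :
    E.ProjMonodromyConj E' ↔ (c = 0 ↔ c' = 0) := by
  constructor
  · rintro ⟨ρ, ρ', hρ, hρ', hconj⟩
    have key := ((F.isConj_of_isProjMonodromy hρ).symm.trans hconj).trans
      (F'.isConj_of_isProjMonodromy hρ')
    constructor
    · intro hc
      by_contra hc'
      rw [hc, mul_zero] at key
      exact not_isConj_affineMap _ (key.trans (F'.isConj_translation hc'))
    · intro hc'
      by_contra hc
      rw [hc', mul_zero] at key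
      exact not_isConj_affineMap _ (key.symm.trans (F.isConj_translation hc))
  · intro hcc
    refine ⟨_, _, F.isProjMonodromy, F'.isProjMonodromy, ?_⟩
    by_cases hc : c = 0
    · rw [hc, hcc.1 hc]
    · exact (F.isConj_translation hc).trans (F'.isConj_translation (mt hcc.2 hc)).symm

end FrobeniusForm

/-! ### Point transformations on the universal covering -/

/-- The operator of the equation in the variable `w = log x`. -/
def liftOp (E : RegularLDE) (Y : ℂ → ℂ) (w : ℂ) : ℂ :=
  deriv (deriv Y) w - E.p (Complex.exp w) * deriv Y w - E.q (Complex.exp w) * Y w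

theorem op_exp (E : RegularLDE) {f : ℂ → ℂ} {w : ℂ} (hf : AnalyticAt ℂ f (Complex.exp w)) :
    E.op f (Complex.exp w) = E.liftOp (fun v => f (Complex.exp v)) w := by
  have h1 : deriv (fun v => f (Complex.exp v)) =ᶠ[𝓝 w] fun v => eulerD f (Complex.exp v) := by
    filter_upwards [Complex.continuous_exp.continuousAt.eventually hf.eventually_analyticAt] with v hv
    exact (hasDerivAt_comp_exp hv.differentiableAt).deriv
  have hδ : AnalyticAt ℂ (eulerD f) (Complex.exp w) := analyticAt_id.mul hf.deriv
  rw [liftOp, h1.deriv_eq, h1.eq_of_nhds, (hasDerivAt_comp_exp hδ.differentiableAt).deriv, op]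

theorem liftOp_congr (E : RegularLDE) {Y Z : ℂ → ℂ} {w : ℂ} (h : Y =ᶠ[𝓝 w] Z) :
    E.liftOp Y w = E.liftOp Z w := by
  rw [liftOp, liftOp, h.deriv.deriv_eq, h.deriv_eq, h.eq_of_nhds]

/-- The conditions at the point `w` under which `Y = S · (Z ∘ Φ)` satisfies the first equation if and
only if `Z` satisfies the second one at `Φ w`. -/
def GaugeAt (E E' : RegularLDE) (Φ S : ℂ → ℂ) (w : ℂ) : Prop :=
  S w * deriv Φ w ^ 2 * E'.p (Complex.exp (Φ w)) =
    E.p (Complex.exp w) * (S w * deriv Φ w) - 2 * deriv S w * deriv Φ w - S w * deriv (deriv Φ) w ∧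
  S w * deriv Φ w ^ 2 * E'.q (Complex.exp (Φ w)) =
    E.q (Complex.exp w) * S w + E.p (Complex.exp w) * deriv S w - deriv (deriv S) w

/-- The pulled back operator in terms of the 2-jet of `Z`. -/
theorem liftOp_mul_comp (E : RegularLDE) {Φ S Z : ℂ → ℂ} {w : ℂ} (hΦ : AnalyticAt ℂ Φ w)
    (hS : AnalyticAt ℂ S w) (hZ : AnalyticAt ℂ Z (Φ w)) :
    E.liftOp (fun v => S v * Z (Φ v)) w = S w * deriv Φ w ^ 2 * deriv (deriv Z) (Φ w) -
      (E.p (Complex.exp w) * (S w * deriv Φ w) - 2 * deriv S w * deriv Φ w -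
        S w * deriv (deriv Φ) w) * deriv Z (Φ w) -
      (E.q (Complex.exp w) * S w + E.p (Complex.exp w) * deriv S w - deriv (deriv S) w) *
        Z (Φ w) := by
  have h1 : ∀ᶠ v in 𝓝 w, HasDerivAt (fun v => S v * Z (Φ v))
      (deriv S v * Z (Φ v) + S v * (deriv Z (Φ v) * deriv Φ v)) v := by
    filter_upwards [hΦ.eventually_analyticAt, hS.eventually_analyticAt,
      hΦ.continuousAt.eventually hZ.eventually_analyticAt] with v h1 h2 h3
    exact h2.differentiableAt.hasDerivAt.mul
      (h3.differentiableAt.hasDerivAt.comp v h1.differentiableAt.hasDerivAt)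
  have h2 : deriv (fun v => S v * Z (Φ v)) =ᶠ[𝓝 w]
      fun v => deriv S v * Z (Φ v) + S v * (deriv Z (Φ v) * deriv Φ v) := h1.mono fun v hv => hv.deriv
  have dΦ := hΦ.differentiableAt.hasDerivAt
  have dS := hS.differentiableAt.hasDerivAt
  have h3 := (hS.deriv.differentiableAt.hasDerivAt.mul
    (hZ.differentiableAt.hasDerivAt.comp w dΦ)).add
    (dS.mul ((hZ.deriv.differentiableAt.hasDerivAt.comp w dΦ).mul
      hΦ.deriv.differentiableAt.hasDerivAt))
  have h4 : deriv (fun v => deriv S v * Z (Φ v) + S v * (deriv Z (Φ v) * deriv Φ v)) w = _ := h3.deriv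
  rw [liftOp, h2.deriv_eq, h2.eq_of_nhds, h4]
  simp only [Function.comp_apply, Pi.mul_apply]
  ring

namespace GaugeAt

variable {E E' : RegularLDE} {Φ S : ℂ → ℂ} {w : ℂ}

theorem liftOp_eq (h : GaugeAt E E' Φ S w) {Z : ℂ → ℂ} (hΦ : AnalyticAt ℂ Φ w)
    (hS : AnalyticAt ℂ S w) (hZ : AnalyticAt ℂ Z (Φ w)) :
    E.liftOp (fun v => S v * Z (Φ v)) w = S w * deriv Φ w ^ 2 * E'.liftOp Z (Φ w) := by
  rw [E.liftOp_mul_comp hΦ hS hZ, ← h.1, ← h.2, liftOp]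
  ring

/-- An operator of second order is determined by two independent solutions. -/
theorem of_solutions {Z₀ Z₁ : ℂ → ℂ} (hΦ : AnalyticAt ℂ Φ w) (hS : AnalyticAt ℂ S w)
    (h₀ : AnalyticAt ℂ Z₀ (Φ w)) (h₁ : AnalyticAt ℂ Z₁ (Φ w)) (s₀ : E'.liftOp Z₀ (Φ w) = 0)
    (s₁ : E'.liftOp Z₁ (Φ w) = 0) (t₀ : E.liftOp (fun v => S v * Z₀ (Φ v)) w = 0)
    (t₁ : E.liftOp (fun v => S v * Z₁ (Φ v)) w = 0)
    (hW : Z₀ (Φ w) * deriv Z₁ (Φ w) - deriv Z₀ (Φ w) * Z₁ (Φ w) ≠ 0) : GaugeAt E E' Φ S w := by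
  rw [E.liftOp_mul_comp hΦ hS h₀] at t₀
  rw [E.liftOp_mul_comp hΦ hS h₁] at t₁
  rw [liftOp] at s₀ s₁
  constructor
  · apply mul_right_cancel₀ hW
    linear_combination (Z₀ (Φ w)) * t₁ - Z₁ (Φ w) * t₀ -
      S w * deriv Φ w ^ 2 * (Z₀ (Φ w) * s₁ - Z₁ (Φ w) * s₀)
  · apply mul_right_cancel₀ hW
    linear_combination (-deriv Z₀ (Φ w)) * t₁ + deriv Z₁ (Φ w) * t₀ -
      S w * deriv Φ w ^ 2 * (-deriv Z₀ (Φ w) * s₁ + deriv Z₁ (Φ w) * s₀)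

end GaugeAt

/-- Analytic functions of `x` realize all 2-jets at a point `x₀ = exp v₀ ≠ 0`, hence two independent
2-jets satisfying the equation. -/
theorem exists_jets (E : RegularLDE) (v₀ : ℂ) : ∃ f₀ f₁ : ℂ → ℂ,
    AnalyticAt ℂ f₀ (Complex.exp v₀) ∧ AnalyticAt ℂ f₁ (Complex.exp v₀) ∧
    E.liftOp (fun v => f₀ (Complex.exp v)) v₀ = 0 ∧ E.liftOp (fun v => f₁ (Complex.exp v)) v₀ = 0 ∧
    f₀ (Complex.exp v₀) * deriv (fun v => f₁ (Complex.exp v)) v₀ -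
      deriv (fun v => f₀ (Complex.exp v)) v₀ * f₁ (Complex.exp v₀) ≠ 0 := by
  -- `f = α + β (x / x₀) + γ (x / x₀)²` has the 2-jet `(α + β + γ, β + 2 γ, β + 4 γ)`
  let f : ℂ → ℂ → ℂ → ℂ → ℂ := fun α β γ x =>
    α + β * (x / Complex.exp v₀) + γ * (x / Complex.exp v₀) ^ 2
  have han : ∀ α β γ, AnalyticAt ℂ (f α β γ) (Complex.exp v₀) := fun α β γ => by
    have := Complex.exp_ne_zero v₀
    simp only [f]
    fun_prop (disch := exact this)
  have hval : ∀ α β γ, f α β γ (Complex.exp v₀) = α + β + γ := fun α β γ => by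
    have := Complex.exp_ne_zero v₀
    simp only [f]
    field_simp
  have hd : ∀ α β γ v, HasDerivAt (fun v => f α β γ (Complex.exp v))
      (f 0 β (2 * γ) (Complex.exp v)) v := fun α β γ v => by
    have h := ((Complex.hasDerivAt_exp v).div_const (Complex.exp v₀))
    have := ((h.const_mul β).const_add α).add ((h.pow 2).const_mul γ)
    convert! this using 1
    simp only [f]
    push_cast
    ring
  have hd1 : ∀ α β γ, deriv (fun v => f α β γ (Complex.exp v)) = fun v =>
      f 0 β (2 * γ) (Complex.exp v) := fun α β γ => funext fun v => (hd α β γ v).deriv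
  have hop : ∀ α β γ, E.liftOp (fun v => f α β γ (Complex.exp v)) v₀ = (β + 4 * γ) -
      E.p (Complex.exp v₀) * (β + 2 * γ) - E.q (Complex.exp v₀) * (α + β + γ) := fun α β γ => by
    rw [liftOp, hd1, hd1]
    simp only [hval]
    ring
  refine ⟨f (1 + E.q (Complex.exp v₀) / 2) (-E.q (Complex.exp v₀)) (E.q (Complex.exp v₀) / 2),
    f (-1 + (E.p (Complex.exp v₀) - 1) / 2) (1 - (E.p (Complex.exp v₀) - 1))
      ((E.p (Complex.exp v₀) - 1) / 2), han _ _ _, han _ _ _, ?_, ?_, ?_⟩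
  · rw [hop]; ring
  · rw [hop]; ring
  · rw [hd1, hd1, hval, hval]
    simp only [hval]
    ring_nf
    exact one_ne_zero

/-- The lift `w ↦ w + ψ(exp w)` of the germ of diffeomorphism `x ↦ x exp ψ(x)`. -/
def liftMap (ψ : ℂ → ℂ) (w : ℂ) : ℂ := w + ψ (Complex.exp w)

theorem exp_liftMap (ψ : ℂ → ℂ) (w : ℂ) :
    Complex.exp (liftMap ψ w) = Complex.exp w * Complex.exp (ψ (Complex.exp w)) :=
  Complex.exp_add _ _

theorem liftMap_add_two_pi_I (ψ : ℂ → ℂ) (w : ℂ) :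
    liftMap ψ (w + 2 * Real.pi * Complex.I) = liftMap ψ w + 2 * Real.pi * Complex.I := by
  rw [liftMap, liftMap, exp_add_two_pi_I]
  ring

theorem analyticAt_comp_exp {f : ℂ → ℂ} {w : ℂ} (hf : AnalyticAt ℂ f (Complex.exp w)) :
    AnalyticAt ℂ (fun v => f (Complex.exp v)) w :=
  hf.comp analyticAt_cexp

theorem analyticAt_liftMap {ψ : ℂ → ℂ} {w : ℂ} (hψ : AnalyticAt ℂ ψ (Complex.exp w)) :
    AnalyticAt ℂ (liftMap ψ) w :=
  analyticAt_id.add (analyticAt_comp_exp hψ)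

theorem deriv_comp_exp {f : ℂ → ℂ} {w : ℂ} (hf : AnalyticAt ℂ f (Complex.exp w)) :
    deriv (fun v => f (Complex.exp v)) w = eulerD f (Complex.exp w) :=
  (hasDerivAt_comp_exp hf.differentiableAt).deriv

theorem deriv_deriv_comp_exp {f : ℂ → ℂ} {w : ℂ} (hf : AnalyticAt ℂ f (Complex.exp w)) :
    deriv (deriv (fun v => f (Complex.exp v))) w = eulerD (eulerD f) (Complex.exp w) := by
  have h : deriv (fun v => f (Complex.exp v)) =ᶠ[𝓝 w] fun v => eulerD f (Complex.exp v) := by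
    filter_upwards [Complex.continuous_exp.continuousAt.eventually hf.eventually_analyticAt] with v hv
      using deriv_comp_exp hv
  have hδ : AnalyticAt ℂ (eulerD f) (Complex.exp w) := analyticAt_id.mul hf.deriv
  rw [h.deriv_eq, deriv_comp_exp hδ]

theorem deriv_liftMap {ψ : ℂ → ℂ} {w : ℂ} (hψ : AnalyticAt ℂ ψ (Complex.exp w)) :
    deriv (liftMap ψ) w = 1 + eulerD ψ (Complex.exp w) :=
  ((hasDerivAt_id w).add (hasDerivAt_comp_exp hψ.differentiableAt)).deriv

theorem deriv_deriv_liftMap {ψ : ℂ → ℂ} {w : ℂ} (hψ : AnalyticAt ℂ ψ (Complex.exp w)) :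
    deriv (deriv (liftMap ψ)) w = eulerD (eulerD ψ) (Complex.exp w) := by
  have h : deriv (liftMap ψ) =ᶠ[𝓝 w] fun v => 1 + eulerD ψ (Complex.exp v) := by
    filter_upwards [Complex.continuous_exp.continuousAt.eventually hψ.eventually_analyticAt] with v hv
      using deriv_liftMap hv
  have hδ : AnalyticAt ℂ (eulerD ψ) (Complex.exp w) := analyticAt_id.mul hψ.deriv
  rw [h.deriv_eq, deriv_const_add, deriv_comp_exp hδ]

/-- A germ of analytic diffeomorphism fixing the origin is of the form `x exp ψ(x)`. -/
theorem exists_eq_mul_exp {φ : ℂ → ℂ} (hφ : AnalyticAt ℂ φ 0) (h0 : φ 0 = 0) (h1 : deriv φ 0 ≠ 0) :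
    ∃ ψ : ℂ → ℂ, AnalyticAt ℂ ψ 0 ∧ ∀ᶠ x in 𝓝 (0 : ℂ), φ x = x * Complex.exp (ψ x) := by
  have hD : AnalyticAt ℂ (dslope φ 0) 0 := by
    obtain ⟨p, hp⟩ := hφ
    exact hp.has_fpower_series_dslope_fslope.analyticAt
  have hD0 : dslope φ 0 0 ≠ 0 := by rwa [dslope_same]
  refine ⟨fun x => Complex.log (dslope φ 0 x / dslope φ 0 0) + Complex.log (dslope φ 0 0), ?_, ?_⟩
  · refine AnalyticAt.add (AnalyticAt.clog (hD.div analyticAt_const hD0) ?_) analyticAt_const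
    rw [div_self hD0]
    exact Complex.one_mem_slitPlane
  · filter_upwards [hD.continuousAt.eventually_ne hD0] with x hx
    rw [Complex.exp_add, Complex.exp_log (div_ne_zero hx hD0), Complex.exp_log hD0,
      div_mul_cancel₀ _ hD0]
    have := sub_smul_dslope φ 0 x
    rw [h0, sub_zero, sub_zero, smul_eq_mul] at this
    exact this.symm

/-- Analytic equivalence in terms of lifts to the universal covering: with `φ(x) = x exp ψ(x)` and
`t = 1 / s`, the prolonged transformation carries one equation to the other if and only if the
coefficients are related by the gauge conditions. -/
theorem analyticallyEquivalent_iff {E E' : RegularLDE} :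
    E.AnalyticallyEquivalent E' ↔ ∃ ψ s : ℂ → ℂ, AnalyticAt ℂ ψ 0 ∧ AnalyticAt ℂ s 0 ∧ s 0 ≠ 0 ∧
      ∀ᶠ x in 𝓝 (0 : ℂ), ∀ w : ℂ, Complex.exp w = x →
        GaugeAt E E' (liftMap ψ) (fun v => s (Complex.exp v)) w := by
  constructor
  · rintro ⟨φ, t, hφ, h0, h1, ht, ht0, H⟩
    obtain ⟨ψ, hψ, hφψ⟩ := exists_eq_mul_exp hφ h0 h1
    refine ⟨ψ, fun x => (t x)⁻¹, hψ, ht.inv ht0, inv_ne_zero ht0, ?_⟩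
    rw [eventually_nhdsWithin_iff] at H
    filter_upwards [H, hφψ.eventually_nhds, hφ.eventually_analyticAt, hψ.eventually_analyticAt,
      ht.eventually_analyticAt, ht.continuousAt.eventually_ne ht0] with x H hx aφ aψ at' tx w hw
    subst hw
    have H := H (Complex.exp_ne_zero w)
    have aS : AnalyticAt ℂ (fun v => (t (Complex.exp v))⁻¹) w :=
      analyticAt_comp_exp (f := fun x => (t x)⁻¹) (at'.inv tx)
    have eφ : φ (Complex.exp w) = Complex.exp (liftMap ψ w) := by
      rw [exp_liftMap]; exact hx.self_of_nhds
    have key : ∀ f : ℂ → ℂ, AnalyticAt ℂ f (Complex.exp (liftMap ψ w)) →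
        E'.liftOp (fun v => f (Complex.exp v)) (liftMap ψ w) = 0 →
        E.liftOp (fun v => (t (Complex.exp v))⁻¹ * f (Complex.exp (liftMap ψ v))) w = 0 := by
      intro f hf hf0
      rw [← E'.op_exp hf, ← eφ] at hf0
      rw [← eφ] at hf
      have := (H f hf).1 hf0
      rw [E.op_exp (f := fun z => f (φ z) / t z) ((hf.comp aφ).div at' tx)] at this
      rw [← this]
      refine E.liftOp_congr ?_
      filter_upwards [Complex.continuous_exp.continuousAt.eventually hx] with v hv
      rw [exp_liftMap, ← hv, div_eq_inv_mul]
    obtain ⟨f₀, f₁, a₀, a₁, s₀, s₁, hW⟩ := E'.exists_jets (liftMap ψ w)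
    exact GaugeAt.of_solutions (Z₀ := fun v => f₀ (Complex.exp v))
      (Z₁ := fun v => f₁ (Complex.exp v)) (analyticAt_liftMap aψ) aS (analyticAt_comp_exp a₀)
      (analyticAt_comp_exp a₁) s₀ s₁ (key f₀ a₀ s₀) (key f₁ a₁ s₁) hW
  · rintro ⟨ψ, s, hψ, hs, hs0, H⟩
    have aφ : ∀ x, AnalyticAt ℂ ψ x → AnalyticAt ℂ (fun x => x * Complex.exp (ψ x)) x :=
      fun x hx => analyticAt_id.mul hx.cexp
    refine ⟨fun x => x * Complex.exp (ψ x), fun x => (s x)⁻¹, aφ 0 hψ, zero_mul _, ?_, hs.inv hs0,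
      inv_ne_zero hs0, ?_⟩
    · have : deriv (fun x => x * Complex.exp (ψ x)) 0 = _ :=
        ((hasDerivAt_id (0 : ℂ)).mul hψ.cexp.differentiableAt.hasDerivAt).deriv
      rw [this]
      simp
    have hδ : AnalyticAt ℂ (fun x => 1 + eulerD ψ x) 0 :=
      analyticAt_const.add (analyticAt_id.mul hψ.deriv)
    have hδ0 : (fun x => 1 + eulerD ψ x) 0 ≠ 0 := by simp [eulerD]
    rw [eventually_nhdsWithin_iff]
    filter_upwards [H, hψ.eventually_analyticAt, hs.eventually_analyticAt,
      hs.continuousAt.eventually_ne hs0, hδ.continuousAt.eventually_ne hδ0]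
      with x H aψ as sx δx hx f hf
    obtain ⟨w, rfl⟩ : ∃ w, Complex.exp w = x := ⟨Complex.log x, Complex.exp_log hx⟩
    have e1 := exp_liftMap ψ w
    rw [← e1] at hf ⊢
    have aS : AnalyticAt ℂ (fun v => s (Complex.exp v)) w := analyticAt_comp_exp as
    have hfφ : AnalyticAt ℂ (fun z => f (z * Complex.exp (ψ z)) / (s z)⁻¹) (Complex.exp w) := by
      rw [e1] at hf
      exact (AnalyticAt.comp (g := f) (f := fun x => x * Complex.exp (ψ x)) hf (aφ _ aψ)).div (as.inv sx)
        (inv_ne_zero sx)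
    have e2 : (fun v => f (Complex.exp v * Complex.exp (ψ (Complex.exp v))) / (s (Complex.exp v))⁻¹)
        = fun v => s (Complex.exp v) * f (Complex.exp (liftMap ψ v)) := by
      funext v
      rw [exp_liftMap, div_inv_eq_mul, mul_comm]
    have e3 := (H w rfl).liftOp_eq (Z := fun v => f (Complex.exp v)) (analyticAt_liftMap aψ) aS
      (analyticAt_comp_exp hf)
    rw [E'.op_exp hf, E.op_exp hfφ, e2, e3, deriv_liftMap aψ]
    simp [sx, δx]

/-! ### Invariance of the exponents and of the projective monodromy -/

/-- The gauge conditions at the origin identify `p 0` and `q 0`. -/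
theorem AnalyticallyEquivalent.exponents_eq {E E' : RegularLDE} (h : E.AnalyticallyEquivalent E') :
    E.exponents = E'.exponents := by
  obtain ⟨ψ, s, hψ, hs, hs0, H⟩ := analyticallyEquivalent_iff.1 h
  have hφ : AnalyticAt ℂ (fun x => x * Complex.exp (ψ x)) 0 := analyticAt_id.mul hψ.cexp
  have hp' : AnalyticAt ℂ (fun x => E'.p (x * Complex.exp (ψ x))) 0 :=
    AnalyticAt.fun_comp (by simpa using E'.analytic_p) hφ
  have hq' : AnalyticAt ℂ (fun x => E'.q (x * Complex.exp (ψ x))) 0 :=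
    AnalyticAt.fun_comp (by simpa using E'.analytic_q) hφ
  have dψ : AnalyticAt ℂ (eulerD ψ) 0 := analyticAt_id.mul hψ.deriv
  have ddψ : AnalyticAt ℂ (eulerD (eulerD ψ)) 0 := analyticAt_id.mul dψ.deriv
  have ds : AnalyticAt ℂ (eulerD s) 0 := analyticAt_id.mul hs.deriv
  have dds : AnalyticAt ℂ (eulerD (eulerD s)) 0 := analyticAt_id.mul ds.deriv
  have ap := E.analytic_p
  have aq := E.analytic_q
  have key : ∀ᶠ x in 𝓝[≠] (0 : ℂ),
      s x * (1 + eulerD ψ x) ^ 2 * E'.p (x * Complex.exp (ψ x)) =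
        E.p x * (s x * (1 + eulerD ψ x)) - 2 * eulerD s x * (1 + eulerD ψ x) -
          s x * eulerD (eulerD ψ) x ∧
      s x * (1 + eulerD ψ x) ^ 2 * E'.q (x * Complex.exp (ψ x)) =
        E.q x * s x + E.p x * eulerD s x - eulerD (eulerD s) x := by
    rw [eventually_nhdsWithin_iff]
    filter_upwards [H, hψ.eventually_analyticAt, hs.eventually_analyticAt] with x H aψ as hx
    obtain ⟨w, rfl⟩ : ∃ w, Complex.exp w = x := ⟨Complex.log x, Complex.exp_log hx⟩
    have := H w rfl
    rwa [GaugeAt, deriv_liftMap aψ, deriv_deriv_liftMap aψ, deriv_comp_exp as,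
      deriv_deriv_comp_exp as, exp_liftMap] at this
  have k1 := ((ContinuousAt.eventuallyEq_nhds_iff_eventuallyEq_nhdsNE
    (by fun_prop) (by fun_prop)).1 (key.mono fun x hx => hx.1)).eq_of_nhds
  have k2 := ((ContinuousAt.eventuallyEq_nhds_iff_eventuallyEq_nhdsNE
    (by fun_prop) (by fun_prop)).1 (key.mono fun x hx => hx.2)).eq_of_nhds
  have z : ∀ f : ℂ → ℂ, eulerD f 0 = 0 := fun f => zero_mul _
  simp only [z, zero_mul, add_zero, one_pow, mul_one, mul_zero, sub_zero] at k1 k2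
  have k3 : E'.p 0 = E.p 0 := mul_left_cancel₀ hs0 (by rw [k1]; ring)
  have k4 : E'.q 0 = E.q 0 := mul_left_cancel₀ hs0 (by rw [k2]; ring)
  rw [exponents, exponents, k3, k4]

/-- Fundamental pairs are pulled back to fundamental pairs with the same monodromy matrix. -/
theorem AnalyticallyEquivalent.isProjMonodromy {E E' : RegularLDE}
    (h : E.AnalyticallyEquivalent E') {ρ : Matrix.ProjGenLinGroup (Fin 2) ℂ}
    (hρ : E'.IsProjMonodromy ρ) : E.IsProjMonodromy ρ := by
  obtain ⟨ψ, s, hψ, hs, hs0, H⟩ := analyticallyEquivalent_iff.1 h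
  obtain ⟨r', Y₀, Y₁, A, hY, hA, rfl⟩ := hρ
  have hδ : AnalyticAt ℂ (fun x => 1 + eulerD ψ x) 0 :=
    analyticAt_const.add (analyticAt_id.mul hψ.deriv)
  have hδ0 : (fun x => 1 + eulerD ψ x) 0 ≠ 0 := by simp [eulerD]
  have hφ : ContinuousAt (fun x => x * Complex.exp (ψ x)) 0 := by
    have := hψ.continuousAt
    fun_prop
  have hball : ∀ᶠ x in 𝓝 (0 : ℂ), x * Complex.exp (ψ x) ∈ Metric.ball (0 : ℂ) r' :=
    hφ.eventually (by
      simp only [zero_mul]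
      exact Metric.ball_mem_nhds _ hY.pos)
  obtain ⟨r, hr, K⟩ := Metric.eventually_nhds_iff_ball.1 (H.and <| hball.and <|
    hψ.eventually_analyticAt.and <| hs.eventually_analyticAt.and <|
    (hs.continuousAt.eventually_ne hs0).and <| (hδ.continuousAt.eventually_ne hδ0).and <|
    E.analytic_p.eventually_analyticAt.and E.analytic_q.eventually_analyticAt)
  have hΦ : ∀ w ∈ logDisc r, AnalyticAt ℂ (liftMap ψ) w := fun w hw =>
    analyticAt_liftMap (K _ (mem_logDisc.1 hw)).2.2.1
  have hS : ∀ w ∈ logDisc r, AnalyticAt ℂ (fun v => s (Complex.exp v)) w := fun w hw =>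
    analyticAt_comp_exp (K _ (mem_logDisc.1 hw)).2.2.2.1
  have hmaps : ∀ w ∈ logDisc r, liftMap ψ w ∈ logDisc r' := fun w hw => by
    rw [mem_logDisc, exp_liftMap]
    exact (K _ (mem_logDisc.1 hw)).2.1
  have sol : ∀ Y, E'.IsSolution r' Y →
      E.IsSolution r (fun w => s (Complex.exp w) * Y (liftMap ψ w)) := fun Y hsol => by
    have aY : ∀ w ∈ logDisc r, AnalyticAt ℂ Y (liftMap ψ w) := fun w hw =>
      hsol.1.analyticAt ((isOpen_logDisc r').mem_nhds (hmaps w hw))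
    refine ⟨fun w hw => ((hS w hw).mul
      ((aY w hw).comp (hΦ w hw))).differentiableAt.differentiableWithinAt, fun w hw => ?_⟩
    have e1 := ((K _ (mem_logDisc.1 hw)).1 w rfl).liftOp_eq (hΦ w hw) (hS w hw) (aY w hw)
    have e2 : E'.liftOp Y (liftMap ψ w) = 0 := hsol.2 _ (hmaps w hw)
    rw [e2, mul_zero] at e1
    exact e1
  refine ⟨r, _, _, A, ⟨hr, fun x hx => ?_, fun x hx => ?_, sol _ hY.sol₀, sol _ hY.sol₁,
    fun a b hab => hY.indep a b ?_⟩, fun w hw => ?_, rfl⟩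
  · exact (K x hx).2.2.2.2.2.2.1.differentiableAt.differentiableWithinAt
  · exact (K x hx).2.2.2.2.2.2.2.differentiableAt.differentiableWithinAt
  · -- `a Y₀ + b Y₁` vanishes near a point `Φ w₀`, as `Φ` is locally surjective
    obtain ⟨w₀, hw₀⟩ := logDisc_nonempty hr
    have han : AnalyticOnNhd ℂ (fun w => a * Y₀ w + b * Y₁ w) (logDisc r') :=
      ((hY.sol₀.1.const_mul a).add (hY.sol₁.1.const_mul b)).analyticOnNhd (isOpen_logDisc r')
    refine han.eqOn_zero_of_preconnected_of_eventuallyEq_zero (isPreconnected_logDisc hY.pos)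
      (hmaps w₀ hw₀) ?_
    have hne : deriv (liftMap ψ) w₀ ≠ 0 := by
      rw [deriv_liftMap (K _ (mem_logDisc.1 hw₀)).2.2.1]
      exact (K _ (mem_logDisc.1 hw₀)).2.2.2.2.2.1
    have hmap := (hΦ w₀ hw₀).hasStrictDerivAt.map_nhds_eq hne
    rw [Filter.EventuallyEq, ← hmap, eventually_map]
    filter_upwards [(isOpen_logDisc r).mem_nhds hw₀] with w hw
    refine (mul_eq_zero.1 (?_ : s (Complex.exp w) * _ = 0)).resolve_left
      (K _ (mem_logDisc.1 hw)).2.2.2.2.1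
    rw [← hab w hw]
    ring
  · simp only [exp_add_two_pi_I, liftMap_add_two_pi_I]
    obtain ⟨e0, e1⟩ := hA _ (hmaps w hw)
    rw [e0, e1]
    constructor <;> ring

/-! ### Normalization of the quotient of two solutions -/

/-- The implicit function theorem for the equation that has to be satisfied by `ψ` in order that
`x ↦ x exp ψ(x)` carries the quotient `x⁻ᵈ V' + c' log x` to a multiple of `x⁻ᵈ V + c log x`. -/
theorem exists_implicit {V V' : ℂ → ℂ} (hV : AnalyticAt ℂ V 0) (hV' : AnalyticAt ℂ V' 0)
    (d c' a : ℂ) (k : ℕ) (y₀ : ℂ)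
    (h0 : Complex.exp (-d * y₀) * V' 0 + c' * 0 ^ k * y₀ = a * V 0)
    (hD : -d * Complex.exp (-d * y₀) * V' 0 + c' * 0 ^ k ≠ 0) :
    ∃ ψ : ℂ → ℂ, AnalyticAt ℂ ψ 0 ∧ ∀ᶠ x in 𝓝 (0 : ℂ),
      Complex.exp (-d * ψ x) * V' (x * Complex.exp (ψ x)) + c' * x ^ k * ψ x = a * V x := by
  let f : ℂ × ℂ → ℂ := fun u =>
    Complex.exp (-d * u.2) * V' (u.1 * Complex.exp u.2) + c' * u.1 ^ k * u.2 - a * V u.1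
  have hf : AnalyticAt ℂ f (0, y₀) := by
    have h1 : AnalyticAt ℂ (fun u : ℂ × ℂ => V' (u.1 * Complex.exp u.2)) (0, y₀) :=
      AnalyticAt.fun_comp (by simpa using hV') (analyticAt_fst.mul analyticAt_snd.cexp)
    have h2 : AnalyticAt ℂ (fun u : ℂ × ℂ => V u.1) (0, y₀) :=
      AnalyticAt.fun_comp (f := Prod.fst) hV analyticAt_fst
    exact (((analyticAt_const.mul analyticAt_snd).cexp.mul h1).add
      ((analyticAt_const.mul (analyticAt_fst.pow k)).mul analyticAt_snd)).sub
      (analyticAt_const.mul h2)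
  have hcd : ContDiffAt ℂ ⊤ f (0, y₀) := hf.contDiffAt
  have hpart : (fderiv ℂ f (0, y₀) ∘L .inr ℂ ℂ ℂ) 1
      = -d * Complex.exp (-d * y₀) * V' 0 + c' * 0 ^ k := by
    have e1 : HasDerivAt (fun y : ℂ => ((0 : ℂ), y)) ((0 : ℂ), (1 : ℂ)) y₀ :=
      (hasDerivAt_const y₀ (0 : ℂ)).prodMk (hasDerivAt_id y₀)
    have e2 := hf.differentiableAt.hasFDerivAt.comp_hasDerivAt y₀ e1
    have e3 : HasDerivAt (fun y : ℂ => Complex.exp (-d * y) * V' 0 + c' * 0 ^ k * y - a * V 0)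
        (Complex.exp (-d * y₀) * (-d * 1) * V' 0 + c' * 0 ^ k * 1) y₀ :=
      (((((hasDerivAt_id y₀).const_mul (-d)).cexp).mul_const _).add
        ((hasDerivAt_id y₀).const_mul _)).sub_const _
    have e4 : f ∘ (fun y : ℂ => ((0 : ℂ), y))
        = fun y : ℂ => Complex.exp (-d * y) * V' 0 + c' * 0 ^ k * y - a * V 0 := by
      funext y
      simp [f]
    rw [e4] at e2
    have e5 := e2.unique e3
    change fderiv ℂ f (0, y₀) (0, 1) = _
    rw [e5]
    ring
  have hinv : (fderiv ℂ f (0, y₀) ∘L .inr ℂ ℂ ℂ).IsInvertible := by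
    refine ⟨ContinuousLinearEquiv.unitsEquivAut ℂ (Units.mk0 _ hD), ?_⟩
    ext
    rw [hpart]
    simp
  refine ⟨hcd.implicitFunction (by simp) hinv, ?_, ?_⟩
  · have := hcd.contDiffAt_implicitFunction (by simp) hinv
    exact this.analyticAt
  · filter_upwards [hcd.eventually_apply_implicitFunction (by simp) hinv] with x hx
    have h0' : f (0, y₀) = 0 := by
      simp only [f, zero_mul]
      rw [h0, sub_self]
    rw [h0'] at hx
    exact sub_eq_zero.1 hx

theorem liftOp_const_mul (E : RegularLDE) (a : ℂ) (Y : ℂ → ℂ) (w : ℂ) :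
    E.liftOp (fun v => a * Y v) w = a * E.liftOp Y w := by
  have : deriv (fun v => a * Y v) = fun v => a * deriv Y v :=
    funext fun v => deriv_const_mul_field a
  rw [liftOp, liftOp, this, deriv_const_mul_field]
  ring

/-- Two equations with the same exponents, both with or both without logarithms, are analytically
equivalent: a diffeomorphism carries the quotient of the Frobenius solutions of one to a multiple of
that of the other, and the factor `t` is then given by the quotient of the first Frobenius
solutions. -/
theorem FrobeniusForm.analyticallyEquivalent {E E' : RegularLDE} {l₁ l₂ : ℂ} {k : ℕ} {c c' : ℂ}
    {r r' : ℝ} {h h' V V' : ℂ → ℂ} (F : E.FrobeniusForm l₁ l₂ k c r h V)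
    (F' : E'.FrobeniusForm l₁ l₂ k c' r' h' V') (hcc : c = 0 ↔ c' = 0) :
    E.AnalyticallyEquivalent E' := by
  obtain ⟨a, ha, hac⟩ : ∃ a : ℂ, a ≠ 0 ∧ a * c = c' := by
    by_cases hc : c = 0
    · exact ⟨1, one_ne_zero, by rw [hc, hcc.1 hc, mul_zero]⟩
    · exact ⟨c' / c, div_ne_zero (mt hcc.2 hc) hc, div_mul_cancel₀ _ hc⟩
  have hV0 : AnalyticAt ℂ V 0 := F.holo_V.analyticAt (Metric.ball_mem_nhds _ F.pos)
  have hV0' : AnalyticAt ℂ V' 0 := F'.holo_V.analyticAt (Metric.ball_mem_nhds _ F'.pos)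
  -- the initial value `ψ 0`: an exponential equation for `l₁ ≠ l₂`, a linear one for `l₁ = l₂`
  obtain ⟨ψ, hψ, eψ⟩ : ∃ ψ : ℂ → ℂ, AnalyticAt ℂ ψ 0 ∧ ∀ᶠ x in 𝓝 (0 : ℂ),
      Complex.exp (-(l₁ - l₂) * ψ x) * V' (x * Complex.exp (ψ x)) + c' * x ^ k * ψ x = a * V x := by
    by_cases hl : l₁ = l₂
    · have hc' := F'.log_of_eq hl
      have hk : k = 0 := by
        have := F'.resonance.resolve_left hc'
        rw [hl, sub_self] at this
        exact_mod_cast this.symm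
      refine exists_implicit hV0 hV0' _ _ _ _ ((a * V 0 - V' 0) / c') ?_ ?_
      · rw [hl, hk]
        field_simp
        simp
      · rw [hl, hk]
        simpa using hc'
    · have hd : l₁ - l₂ ≠ 0 := sub_ne_zero.2 hl
      have hck : c' * (0 : ℂ) ^ k = 0 := by
        rcases F'.resonance with h0 | h0
        · rw [h0, zero_mul]
        · have : k ≠ 0 := by
            rintro rfl
            exact hd (by simpa using h0)
          rw [zero_pow this, mul_zero]
      have hv := F.V_ne hl
      have hv' := F'.V_ne hl
      have he : Complex.exp (-(l₁ - l₂) * (-Complex.log (a * V 0 / V' 0) / (l₁ - l₂)))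
          = a * V 0 / V' 0 := by
        rw [neg_mul, mul_div_cancel₀ _ hd, neg_neg,
          Complex.exp_log (div_ne_zero (mul_ne_zero ha hv) hv')]
      refine exists_implicit hV0 hV0' _ _ _ _ (-Complex.log (a * V 0 / V' 0) / (l₁ - l₂)) ?_ ?_
      · rw [he, hck]
        field_simp
        ring
      · rw [he, hck, add_zero]
        exact mul_ne_zero (mul_ne_zero (neg_ne_zero.2 hd) (div_ne_zero (mul_ne_zero ha hv) hv')) hv'
  have hφ : AnalyticAt ℂ (fun x => x * Complex.exp (ψ x)) 0 := analyticAt_id.mul hψ.cexp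
  have hball : ∀ᶠ x in 𝓝 (0 : ℂ), x * Complex.exp (ψ x) ∈ Metric.ball (0 : ℂ) r' :=
    hφ.continuousAt.eventually (by
      simp only [zero_mul]
      exact Metric.ball_mem_nhds _ F'.pos)
  set s : ℂ → ℂ := fun x =>
    h x / (Complex.exp (l₁ * ψ x) * h' (x * Complex.exp (ψ x))) with hsdef
  have hs : ∀ x ∈ Metric.ball (0 : ℂ) r, AnalyticAt ℂ ψ x →
      x * Complex.exp (ψ x) ∈ Metric.ball (0 : ℂ) r' → AnalyticAt ℂ s x ∧ s x ≠ 0 := by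
    intro x hx aψ hx'
    have a1 : AnalyticAt ℂ (fun x => h' (x * Complex.exp (ψ x))) x :=
      AnalyticAt.fun_comp (F'.holo_h.analyticAt (Metric.isOpen_ball.mem_nhds hx'))
        (analyticAt_id.mul aψ.cexp)
    have hne := mul_ne_zero (Complex.exp_ne_zero (l₁ * ψ x)) (F'.h_ne _ hx')
    exact ⟨(F.holo_h.analyticAt (Metric.isOpen_ball.mem_nhds hx)).div
      ((analyticAt_const.mul aψ).cexp.mul a1) hne, div_ne_zero (F.h_ne _ hx) hne⟩
  have h0r : (0 : ℂ) ∈ Metric.ball (0 : ℂ) r := Metric.mem_ball_self F.pos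
  obtain ⟨s0, s0'⟩ := hs 0 h0r hψ hball.self_of_nhds
  refine analyticallyEquivalent_iff.2 ⟨ψ, s, hψ, s0, s0', ?_⟩
  filter_upwards [eψ.eventually_nhds, hball.eventually_nhds, hψ.eventually_analyticAt,
    (Metric.isOpen_ball.mem_nhds h0r)] with x ex bx aψ hx w hw
  subst hw
  have hw : w ∈ logDisc r := mem_logDisc.2 hx
  have hΦ : liftMap ψ w ∈ logDisc r' := by
    rw [mem_logDisc, exp_liftMap]
    exact bx.self_of_nhds
  have hU := (isOpen_logDisc r').mem_nhds hΦ
  have y0 : (fun v => s (Complex.exp v) * frobeniusSolution l₁ h' (liftMap ψ v)) =ᶠ[𝓝 w]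
      frobeniusSolution l₁ h := by
    filter_upwards [Complex.continuous_exp.continuousAt.eventually bx] with v hv
    have hne := F'.h_ne _ hv
    rw [frobeniusSolution, frobeniusSolution, exp_liftMap, liftMap, mul_add, Complex.exp_add, hsdef]
    field_simp
  have q0 : (fun v => frobeniusQuotient (l₁ - l₂) c' V' (liftMap ψ v)) =ᶠ[𝓝 w]
      fun v => a * frobeniusQuotient (l₁ - l₂) c V v := by
    filter_upwards [Complex.continuous_exp.continuousAt.eventually ex] with v hv
    have e1 := resonant_mul_exp F'.resonance v
    rw [frobeniusQuotient, frobeniusQuotient, exp_liftMap, liftMap, mul_add, Complex.exp_add]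
    linear_combination Complex.exp (-(l₁ - l₂) * v) * hv - ψ (Complex.exp v) * e1 - v * hac
  have y1 : (fun v => s (Complex.exp v) * (frobeniusSolution l₁ h' (liftMap ψ v) *
      frobeniusQuotient (l₁ - l₂) c' V' (liftMap ψ v))) =ᶠ[𝓝 w]
      fun v => a * (frobeniusSolution l₁ h v * frobeniusQuotient (l₁ - l₂) c V v) := by
    filter_upwards [y0, q0] with v h1 h2
    rw [← mul_assoc, h1, h2]
    ring
  refine GaugeAt.of_solutions (Z₀ := frobeniusSolution l₁ h')
    (Z₁ := fun w => frobeniusSolution l₁ h' w * frobeniusQuotient (l₁ - l₂) c' V' w)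
    (analyticAt_liftMap aψ) (analyticAt_comp_exp (hs _ hx aψ bx.self_of_nhds).1)
    (F'.sol₀.1.analyticAt hU) (F'.sol₁.1.analyticAt hU) (F'.sol₀.2 _ hΦ) (F'.sol₁.2 _ hΦ) ?_ ?_
    (F'.wronskian_ne_zero hΦ)
  · rw [E.liftOp_congr y0]
    exact F.sol₀.2 w hw
  · rw [E.liftOp_congr y1, liftOp_const_mul]
    exact mul_eq_zero_of_right a (F.sol₁.2 w hw)

/-! ### The normal forms -/

theorem eulerD_const (a : ℂ) (x : ℂ) : eulerD (fun _ => a) x = 0 := by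
  rw [eulerD, deriv_const, mul_zero]

theorem normalFormA_comm (l₁ l₂ : ℂ) : normalFormA l₁ l₂ = normalFormA l₂ l₁ := by
  simp only [normalFormA, ofFactors, eulerD_const, RegularLDE.mk.injEq]
  exact ⟨funext fun _ => add_comm _ _, funext fun _ => by rw [mul_comm]⟩

theorem frobeniusForm_normalFormA {l₁ l₂ : ℂ} (hl : l₁ ≠ l₂) (k : ℕ) {r : ℝ} (hr : 0 < r) :
    (normalFormA l₂ l₁).FrobeniusForm l₁ l₂ k 0 r (fun _ => 1) (fun _ => 1) := by
  refine .of_factors (α₁ := fun _ => l₁) (α₂ := fun _ => l₂) (g := fun _ => -(l₁ - l₂)) hr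
    (by fun_prop) (by fun_prop) (by fun_prop) (by fun_prop) (by fun_prop) (fun _ _ => rfl)
    (fun _ _ => rfl) (fun _ _ => one_ne_zero) (fun _ _ => neg_ne_zero.2 (sub_ne_zero.2 hl))
    (fun x _ => ?_) (fun x _ => ?_) (fun x _ => ?_) (.inl rfl) (fun h => absurd h hl)
    (fun _ => one_ne_zero) <;> simp [eulerD_const]

theorem frobeniusForm_normalFormB (l : ℂ) {r : ℝ} (hr : 0 < r) :
    (normalFormB l).FrobeniusForm l l 0 1 r (fun _ => 1) (fun _ => 0) := by
  refine .of_factors (α₁ := fun _ => l) (α₂ := fun _ => l) (g := fun _ => 1) hr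
    (by fun_prop) (by fun_prop) (by fun_prop) (by fun_prop) (by fun_prop) (fun _ _ => rfl)
    (fun _ _ => rfl) (fun _ _ => one_ne_zero) (fun _ _ => one_ne_zero)
    (fun x _ => ?_) (fun x _ => ?_) (fun x _ => ?_) (.inr (by simp)) (fun _ => one_ne_zero)
    (fun h => absurd rfl h) <;> simp [eulerD_const]

theorem frobeniusForm_normalFormC {l₁ l₂ : ℂ} {k : ℕ} (hk : 0 < k) (hl : l₁ - l₂ = k) {r : ℝ}
    (hr : 0 < r) (hr1 : r ≤ 1) :
    (normalFormC l₂ l₁ k hk).FrobeniusForm l₁ l₂ k k r (fun _ => 1) (fun _ => 1) := by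
  have hk0 : (k : ℂ) ≠ 0 := Nat.cast_ne_zero.2 hk.ne'
  have hx : ∀ x ∈ Metric.ball (0 : ℂ) r, (1 : ℂ) - x ^ k ≠ 0 := fun x hx h0 => by
    rw [mem_ball_zero_iff] at hx
    have h1 : ‖x ^ k‖ < 1 := by
      rw [norm_pow]
      exact pow_lt_one₀ (norm_nonneg _) (hx.trans_le hr1) hk.ne'
    rw [← sub_eq_zero.1 h0, norm_one] at h1
    exact lt_irrefl _ h1
  have hne : l₁ ≠ l₂ := fun h => hk0 (by rw [← hl, h, sub_self])
  refine .of_factors (α₁ := fun _ => l₁) (α₂ := fun x => l₂ - k * (x ^ k / (1 - x ^ k)))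
    (g := fun x => -k * (1 - x ^ k)) hr (by fun_prop) ?_ (by fun_prop) (by fun_prop) (by fun_prop)
    (fun _ _ => rfl) (fun _ _ => rfl) (fun _ _ => one_ne_zero)
    (fun x h => mul_ne_zero (neg_ne_zero.2 hk0) (hx x h))
    (fun x _ => ?_) (fun x h => ?_) (fun x _ => ?_) (.inr hl) (fun h => absurd h hne)
    (fun _ => one_ne_zero)
  · fun_prop (disch := exact hx)
  · simp [eulerD_const]
  · have h1 : HasDerivAt (fun x : ℂ => -(k : ℂ) * (1 - x ^ k))
        (-(k : ℂ) * -((k : ℂ) * x ^ (k - 1))) x :=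
      ((hasDerivAt_pow k x).const_sub 1).const_mul _
    have h2 : x ^ k = x * x ^ (k - 1) := by rw [← pow_succ', Nat.sub_add_cancel hk]
    have h3 := hx x h
    rw [eulerD, h1.deriv]
    have h4 : x ^ k / (1 - x ^ k) * (1 - x ^ k) = x ^ k := div_mul_cancel₀ _ h3
    linear_combination (-(k : ℂ) ^ 2) * h2 - (k : ℂ) ^ 2 * h4
  · simp only [eulerD_const, hl]
    ring

/-- For the second resonant normal form `g` is a multiple of `exp (-xᵏ)`, whose `k`-th Taylor
coefficient does not vanish: a logarithm occurs. -/
theorem exists_frobeniusForm_normalFormD {l₁ l₂ : ℂ} {k : ℕ} (hk : 0 < k) (hl : l₁ - l₂ = k) :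
    ∃ (c : ℂ) (r : ℝ) (h V : ℂ → ℂ), c ≠ 0 ∧
      (normalFormD l₂ l₁ k).FrobeniusForm l₁ l₂ k c r h V := by
  have hk0 : (k : ℂ) ≠ 0 := Nat.cast_ne_zero.2 hk.ne'
  have hne : l₁ ≠ l₂ := fun h => hk0 (by rw [← hl, h, sub_self])
  -- solve `s W' - W = exp (-s) - c s` in the variable `s = xᵏ`; differentiation at `0` gives `c = -1`
  obtain ⟨c, W, hW, -, eW⟩ := exists_eulerD_sub_mul_eq (G := fun s => Complex.exp (-s))
    (by fun_prop) 1 1 (fun n hn => by exact_mod_cast hn.symm)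
  have hδ : AnalyticAt ℂ (eulerD W) 0 := analyticAt_id.mul hW.deriv
  have hc : c = -1 := by
    have e1 : HasDerivAt (fun s => eulerD W s - 1 * W s) _ 0 :=
      hδ.differentiableAt.hasDerivAt.sub (hW.differentiableAt.hasDerivAt.const_mul 1)
    have e2 : HasDerivAt (fun s : ℂ => Complex.exp (-s) - c * s ^ 1)
        (Complex.exp (-0) * -1 - c * 1) 0 := by
      simp only [pow_one]
      exact (hasDerivAt_neg 0).cexp.sub ((hasDerivAt_id 0).const_mul c)
    have e3 : HasDerivAt (eulerD W) (1 * deriv W 0 + 0 * deriv (deriv W) 0) 0 :=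
      (hasDerivAt_id (0 : ℂ)).mul hW.deriv.differentiableAt.hasDerivAt
    have e4 := (e1.congr_of_eventuallyEq (EventuallyEq.symm eW)).unique e2
    rw [e3.deriv, neg_zero, Complex.exp_zero] at e4
    linear_combination e4
  have eW0 : -W 0 = 1 := by simpa [eulerD] using eW.self_of_nhds
  have hpow : Tendsto (fun x : ℂ => x ^ k) (𝓝 0) (𝓝 0) := by
    have := (continuous_pow k).tendsto (0 : ℂ)
    rwa [zero_pow hk.ne'] at this
  obtain ⟨r, hr, H⟩ := Metric.eventually_nhds_iff_ball.1
    (hpow.eventually (eW.and hW.eventually_analyticAt))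
  have hd : ∀ x ∈ Metric.ball (0 : ℂ) r, HasDerivAt (fun x => W (x ^ k))
      (deriv W (x ^ k) * (k * x ^ (k - 1))) x := fun x hx =>
    (H x hx).2.differentiableAt.hasDerivAt.comp x (hasDerivAt_pow k x)
  have hx1 : ∀ x : ℂ, x ^ k = x * x ^ (k - 1) := fun x => by
    rw [← pow_succ', Nat.sub_add_cancel hk]
  refine ⟨-k, r, fun _ => 1, fun x => W (x ^ k), neg_ne_zero.2 hk0,
    .of_factors (α₁ := fun _ => l₁) (α₂ := fun x => l₂ - k * x ^ k)
    (g := fun x => k * Complex.exp (-x ^ k)) hr (by fun_prop) (by fun_prop) (by fun_prop)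
    (by fun_prop) (fun x hx => (hd x hx).differentiableAt.differentiableWithinAt)
    (fun _ _ => rfl) (fun _ _ => rfl) (fun _ _ => one_ne_zero)
    (fun x _ => mul_ne_zero hk0 (Complex.exp_ne_zero _)) (fun x _ => ?_) (fun x _ => ?_)
    (fun x hx => ?_) (.inr hl) (fun h => absurd h hne) (fun _ h0 => ?_)⟩
  · simp [eulerD_const]
  · have h1 : HasDerivAt (fun x : ℂ => (k : ℂ) * Complex.exp (-x ^ k))
        (k * (Complex.exp (-x ^ k) * -(k * x ^ (k - 1)))) x :=
      ((hasDerivAt_pow k x).neg.cexp).const_mul _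
    rw [eulerD, h1.deriv, hx1]
    ring
  · have h1 := (H x hx).1
    rw [hc, pow_one, eulerD] at h1
    rw [hl, eulerD, (hd x hx).deriv]
    have := hx1 x
    linear_combination (k : ℂ) * h1 - k * deriv W (x ^ k) * this
  · rw [zero_pow hk.ne'] at h0
    simp [h0] at eW0

/-! ### Bases of solutions of the normal forms -/

theorem isSolutionBasis_normalFormA {l₁ l₂ : ℂ} (hl : l₁ ≠ l₂) {r : ℝ} (hr : 0 < r) :
    (normalFormA l₂ l₁).IsSolutionBasis r
      (fun w => Complex.exp (l₁ * w)) (fun w => Complex.exp (l₂ * w)) := by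
  have := (frobeniusForm_normalFormA hl 0 hr).isSolutionBasis
  convert! this using 1
  · funext w
    simp [frobeniusSolution]
  · funext w
    simp only [frobeniusSolution, frobeniusQuotient, mul_one, zero_mul, add_zero]
    rw [← Complex.exp_add]
    ring_nf

theorem isSolutionBasis_normalFormB (l : ℂ) {r : ℝ} (hr : 0 < r) :
    (normalFormB l).IsSolutionBasis r
      (fun w => Complex.exp (l * w)) (fun w => w * Complex.exp (l * w)) := by
  have := (frobeniusForm_normalFormB l hr).isSolutionBasis
  convert! this using 1
  · funext w
    simp [frobeniusSolution]
  · funext w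
    simp [frobeniusSolution, frobeniusQuotient, mul_comm]

theorem isSolutionBasis_normalFormC {l₁ l₂ : ℂ} {k : ℕ} (hk : 0 < k) (hl : l₁ - l₂ = k) {r : ℝ}
    (hr : 0 < r) (hr1 : r ≤ 1) :
    (normalFormC l₂ l₁ k hk).IsSolutionBasis r (fun w => Complex.exp (l₁ * w))
      (fun w => Complex.exp (l₂ * w) + k * (w * Complex.exp (l₁ * w))) := by
  have := (frobeniusForm_normalFormC hk hl hr hr1).isSolutionBasis
  convert! this using 1
  · funext w
    simp [frobeniusSolution]
  · funext w
    have e : Complex.exp (l₂ * w) = Complex.exp (l₁ * w) * Complex.exp (-(l₁ - l₂) * w) := by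
      rw [← Complex.exp_add]; ring_nf
    rw [frobeniusSolution, frobeniusQuotient, e]
    ring

/-! ### The classification -/

/-- The order of resonance to be allowed for: `l₁ - l₂` if this is a natural number. -/
theorem exists_resonance (d : ℂ) : ∃ k : ℕ, ∀ n : ℕ, d = n → n = k := by
  by_cases h : ∃ k : ℕ, d = k
  · obtain ⟨k, hk⟩ := h
    exact ⟨k, fun n hn => Nat.cast_injective (R := ℂ) (hn.symm.trans hk)⟩
  · exact ⟨0, fun n hn => absurd ⟨n, hn⟩ h⟩

theorem exists_frobeniusForm_of_exponents {E : RegularLDE} {l₁ l₂ : ℂ} {k : ℕ}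
    (hE : E.exponents = {l₁, l₂}) (hl : ∀ n : ℕ, ((n + 1 : ℕ) : ℂ) + (l₁ - l₂) ≠ 0)
    (hk : ∀ n : ℕ, l₁ - l₂ = n → n = k) :
    ∃ (c : ℂ) (r : ℝ) (h V : ℂ → ℂ), E.FrobeniusForm l₁ l₂ k c r h V :=
  E.exists_frobeniusForm (exponents_eq_iff.1 hE).1 (exponents_eq_iff.1 hE).2 hl k hk

/-- Simultaneous Frobenius bases of two equations with the same exponents. -/
theorem exists_common_frobeniusForm {E E' : RegularLDE} (h : E.exponents = E'.exponents) :
    ∃ (l₁ l₂ : ℂ) (k : ℕ) (c c' : ℂ) (r r' : ℝ) (f f' V V' : ℂ → ℂ),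
      E.FrobeniusForm l₁ l₂ k c r f V ∧ E'.FrobeniusForm l₁ l₂ k c' r' f' V' := by
  obtain ⟨l₁, l₂, hE, hl⟩ := E.exists_admissible_exponents
  obtain ⟨k, hk⟩ := exists_resonance (l₁ - l₂)
  obtain ⟨c, r, f, V, F⟩ := exists_frobeniusForm_of_exponents hE hl hk
  obtain ⟨c', r', f', V', F'⟩ := exists_frobeniusForm_of_exponents (h ▸ hE) hl hk
  exact ⟨l₁, l₂, k, c, c', r, r', f, f', V, V', F, F'⟩

theorem analyticallyEquivalent_iff_exponents_monodromy (E E' : RegularLDE) :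
    E.AnalyticallyEquivalent E' ↔ E.exponents = E'.exponents ∧ E.ProjMonodromyConj E' := by
  constructor
  · intro h
    obtain ⟨l₁, l₂, k, c, c', r, r', f, f', V, V', F, F'⟩ :=
      exists_common_frobeniusForm h.exponents_eq
    exact ⟨h.exponents_eq, _, _, h.isProjMonodromy F'.isProjMonodromy, F'.isProjMonodromy, .refl _⟩
  · rintro ⟨h, hm⟩
    obtain ⟨l₁, l₂, k, c, c', r, r', f, f', V, V', F, F'⟩ := exists_common_frobeniusForm h
    exact F.analyticallyEquivalent F' ((F.projMonodromyConj_iff F').1 hm)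

theorem projMonodromyConj_iff_diagonalizable {E E' : RegularLDE} (h : E.exponents = E'.exponents) :
    E.ProjMonodromyConj E' ↔
      (E.DiagonalizableMonodromy ∧ E'.DiagonalizableMonodromy) ∨
      (E.NonDiagonalizableMonodromy ∧ E'.NonDiagonalizableMonodromy) := by
  obtain ⟨l₁, l₂, k, c, c', r, r', f, f', V, V', F, F'⟩ := exists_common_frobeniusForm h
  rw [F.projMonodromyConj_iff F', F.diagonalizableMonodromy_iff, F'.diagonalizableMonodromy_iff,
    F.nonDiagonalizableMonodromy_iff, F'.nonDiagonalizableMonodromy_iff]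
  tauto

theorem not_diagonalizable_and_nonDiagonalizable (E : RegularLDE) :
    ¬ (E.DiagonalizableMonodromy ∧ E.NonDiagonalizableMonodromy) := by
  obtain ⟨l₁, l₂, k, c, c', r, r', f, f', V, V', F, F'⟩ :=
    exists_common_frobeniusForm (E := E) (E' := E) rfl
  rw [F.diagonalizableMonodromy_iff, F.nonDiagonalizableMonodromy_iff]
  tauto

theorem trichotomy (E : RegularLDE) : ∃ l₁ l₂ : ℂ, E.exponents = {l₁, l₂} ∧
    ((E.DiagonalizableMonodromy ∧ l₁ ≠ l₂) ∨
      (E.NonDiagonalizableMonodromy ∧ l₁ = l₂) ∨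
      (E.NonDiagonalizableMonodromy ∧ ∃ k : ℕ, 0 < k ∧ l₁ - l₂ = k)) := by
  obtain ⟨l₁, l₂, hE, hl⟩ := E.exists_admissible_exponents
  obtain ⟨k, hk⟩ := exists_resonance (l₁ - l₂)
  obtain ⟨c, r, f, V, F⟩ := exists_frobeniusForm_of_exponents hE hl hk
  refine ⟨l₁, l₂, hE, ?_⟩
  by_cases hc : c = 0
  · exact .inl ⟨F.diagonalizableMonodromy hc, fun h => F.log_of_eq h hc⟩
  · by_cases h : l₁ = l₂
    · exact .inr (.inl ⟨F.nonDiagonalizableMonodromy hc, h⟩)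
    · have hd := F.resonance.resolve_left hc
      refine .inr (.inr ⟨F.nonDiagonalizableMonodromy hc, k, Nat.pos_of_ne_zero ?_, hd⟩)
      rintro rfl
      exact h (sub_eq_zero.1 (by simpa using hd))

theorem analyticallyEquivalent_normalFormA {E : RegularLDE} {l₁ l₂ : ℂ}
    (hE : E.exponents = {l₁, l₂}) (hd : E.DiagonalizableMonodromy) :
    l₁ ≠ l₂ ∧ E.AnalyticallyEquivalent (normalFormA l₂ l₁) := by
  wlog hl : ∀ n : ℕ, ((n + 1 : ℕ) : ℂ) + (l₁ - l₂) ≠ 0 generalizing l₁ l₂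
  · have := this (hE.trans (Multiset.pair_comm _ _)) ((admissible_or_swap l₁ l₂).resolve_left hl)
    rw [normalFormA_comm]
    exact ⟨this.1.symm, this.2⟩
  obtain ⟨k, hk⟩ := exists_resonance (l₁ - l₂)
  obtain ⟨c, r, f, V, F⟩ := exists_frobeniusForm_of_exponents hE hl hk
  have hc := F.diagonalizableMonodromy_iff.1 hd
  have hne : l₁ ≠ l₂ := fun h => F.log_of_eq h hc
  exact ⟨hne, F.analyticallyEquivalent (frobeniusForm_normalFormA hne k one_pos) (by simp [hc])⟩

theorem analyticallyEquivalent_normalFormB {E : RegularLDE} {l : ℂ} (hE : E.exponents = {l, l}) :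
    E.NonDiagonalizableMonodromy ∧ E.AnalyticallyEquivalent (normalFormB l) := by
  obtain ⟨c, r, f, V, F⟩ := exists_frobeniusForm_of_exponents (k := 0) hE
    (fun n => by rw [sub_self, add_zero]; exact Nat.cast_ne_zero.2 n.succ_ne_zero)
    (fun n hn => by simpa using hn.symm)
  have hc := F.log_of_eq rfl
  exact ⟨F.nonDiagonalizableMonodromy hc,
    F.analyticallyEquivalent (frobeniusForm_normalFormB l one_pos) (by simp [hc])⟩

theorem analyticallyEquivalent_normalFormC {E : RegularLDE} {l₁ l₂ : ℂ}
    (hE : E.exponents = {l₁, l₂}) {k : ℕ} (hk : 0 < k) (hl : l₁ - l₂ = k)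
    (hd : E.NonDiagonalizableMonodromy) :
    E.AnalyticallyEquivalent (normalFormC l₂ l₁ k hk) ∧
      E.AnalyticallyEquivalent (normalFormD l₂ l₁ k) := by
  obtain ⟨c, r, f, V, F⟩ := exists_frobeniusForm_of_exponents (k := k) hE
    (fun n => by
      rw [hl, ← Nat.cast_add]
      exact Nat.cast_ne_zero.2 (by omega))
    (fun n hn => Nat.cast_injective (R := ℂ) (hn.symm.trans hl))
  have hc := F.nonDiagonalizableMonodromy_iff.1 hd
  obtain ⟨c', r', f', V', hc', F'⟩ := exists_frobeniusForm_normalFormD hk hl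
  exact ⟨F.analyticallyEquivalent (frobeniusForm_normalFormC hk hl one_pos le_rfl)
    (by simp [hc, hk.ne']), F.analyticallyEquivalent F' (by simp [hc, hc'])⟩

end RegularLDE

end

theorem theoremB1 :
    -- the classification: exponents and conjugacy class of the projective monodromy
    (∀ E E' : RegularLDE,
      E.AnalyticallyEquivalent E' ↔ E.exponents = E'.exponents ∧ E.ProjMonodromyConj E') ∧
    -- for equal exponents, conjugacy means that both are diagonalizable or both are not
    (∀ E E' : RegularLDE, E.exponents = E'.exponents →
      (E.ProjMonodromyConj E' ↔
        (E.DiagonalizableMonodromy ∧ E'.DiagonalizableMonodromy) ∨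
        (E.NonDiagonalizableMonodromy ∧ E'.NonDiagonalizableMonodromy))) ∧
    (∀ E : RegularLDE, ¬ (E.DiagonalizableMonodromy ∧ E.NonDiagonalizableMonodromy)) ∧
    -- reducibility
    (∀ E : RegularLDE, E.IsReducible) ∧
    -- every equation falls into one of the three cases
    (∀ E : RegularLDE, ∃ l₁ l₂ : ℂ, E.exponents = {l₁, l₂} ∧
      ((E.DiagonalizableMonodromy ∧ l₁ ≠ l₂) ∨
        (E.NonDiagonalizableMonodromy ∧ l₁ = l₂) ∨
        (E.NonDiagonalizableMonodromy ∧ ∃ k : ℕ, 0 < k ∧ l₁ - l₂ = k))) ∧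
    -- the normal forms in the three cases
    (∀ (E : RegularLDE) (l₁ l₂ : ℂ), E.exponents = {l₁, l₂} →
      (E.DiagonalizableMonodromy →
        l₁ ≠ l₂ ∧ E.AnalyticallyEquivalent (RegularLDE.normalFormA l₂ l₁)) ∧
      (l₁ = l₂ →
        E.NonDiagonalizableMonodromy ∧ E.AnalyticallyEquivalent (RegularLDE.normalFormB l₁)) ∧
      (∀ (k : ℕ) (hk : 0 < k), l₁ - l₂ = k → E.NonDiagonalizableMonodromy →
        E.AnalyticallyEquivalent (RegularLDE.normalFormC l₂ l₁ k hk) ∧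
        E.AnalyticallyEquivalent (RegularLDE.normalFormD l₂ l₁ k))) ∧
    -- bases of solutions of the normal forms, in the variable `w = log x`
    (∀ (l₁ l₂ : ℂ) (r : ℝ), 0 < r → l₁ ≠ l₂ →
      (RegularLDE.normalFormA l₂ l₁).IsSolutionBasis r
        (fun w => Complex.exp (l₁ * w)) (fun w => Complex.exp (l₂ * w))) ∧
    (∀ (l₁ : ℂ) (r : ℝ), 0 < r →
      (RegularLDE.normalFormB l₁).IsSolutionBasis r
        (fun w => Complex.exp (l₁ * w)) (fun w => w * Complex.exp (l₁ * w))) ∧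
    (∀ (l₁ l₂ : ℂ) (k : ℕ) (hk : 0 < k) (r : ℝ), 0 < r → r ≤ 1 → l₁ - l₂ = k →
      (RegularLDE.normalFormC l₂ l₁ k hk).IsSolutionBasis r
        (fun w => Complex.exp (l₁ * w))
        (fun w => Complex.exp (l₂ * w) + k * (w * Complex.exp (l₁ * w)))) := by
  open RegularLDE in
  exact ⟨analyticallyEquivalent_iff_exponents_monodromy,
    fun _ _ => projMonodromyConj_iff_diagonalizable, not_diagonalizable_and_nonDiagonalizable,
    isReducible, trichotomy, fun _ _ _ hE =>
      ⟨analyticallyEquivalent_normalFormA hE,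
        fun h => by subst h; exact analyticallyEquivalent_normalFormB hE,
        fun _ hk hl => analyticallyEquivalent_normalFormC hE hk hl⟩,
    fun _ _ _ hr hl => isSolutionBasis_normalFormA hl hr,
    fun l _ hr => isSolutionBasis_normalFormB l hr,
    fun _ _ _ hk _ hr hr1 hl => isSolutionBasis_normalFormC hk hl hr hr1⟩
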